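/- Fix $d\in\mathbb N$, $T>0$ and $M_0>0$. For $X=\mathbb R^d$ or $X=\mathbb R^{2d}$ let $\mathcal P_1(X)$ be the set of Borel probability measures on $X$ with finite first moment, metrized by the Wasserstein distance $d_1(m,m')=\inf_{\lambda}\int |x-y|\,d\lambda(x,y)$, the infimum being over all transport plans $\lambda$ between $m$ and $m'$. Assume: * **(M1)** $L_0:\mathbb R^d\times\mathbb R^d\times\mathcal P_1(\mathbb R^d)\to\mathbb R$ is continuous, and $(x,v)\mapsto L_0(x,v,m)$ is of class $C^1$ for every $m$. * **(M2)** For all $(x,v,m)$: $D_v^2L_0(x,v,m)\ge \frac1{M_0}\mathrm{Id}$ (in the sense that $v\mapsto L_0(x,v,m)-\frac1{2M_0}|v|^2$ is convex), $|D_xL_0(x,v,m)|\le M_0(1+|v|^2)$ and $|D_vL_0(x,v,m)|\le M_0(1+|v|)$. * **(M3)** There are non-decreasing $\theta,\omega_0:[0,\infty)\to[0,\infty)$ with $\omega_0(0)=0$ and $\omega_0(r)\to0$ as $r\to0^+$ such that $|L_0(x,v,m_1)-L_0(x,v,m_2)|\le\theta(|x|)\,\omega_0(d_1(m_1,m_2))$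 for all $x,v,m_1,m_2$. * **(BC1)** $\mu_0$ is a probability measure on $\mathbb R^{2d}$, absolutely continuous with respect to the Lebesgue measure, with compact support. * **(BC2)** $g:\mathbb R^d\times\mathcal P_1(\mathbb R^d)\to\mathbb R$; for every $m$ the function $g(\cdot,m)$ is bounded and $C^1$ with uniformly continuous gradient, and $M_0\ge\max\{\frac12,\frac12\|Dg(\cdot,m)\|_\infty\}$; for every $x$ the function $g(x,\cdot)$ is uniformly continuous on $(\mathcal P_1(\mathbb R^d),d_1)$. For every $\varepsilon>0$ let $(u^\varepsilon,\mu^\varepsilon)$ be a solution of the mean field game system with control of acceleration with parameter $\varepsilon$. That is, with $m^\varepsilon_t=\pi_1\sharp\mu^\varepsilon_t$ and $\pi_1(x,v)=x$: $u^\varepsilon$ is locally Lipschitz on $[0,T]\times\mathbb R^{2d}$; $\mu^\varepsilon\in C([0,T];\mathcal P_1(\mathbb R^{2d}))$; for all $(t,x,v)\in[0,T]\times\mathbb R^{2d}$ $$u^\varepsilon(t,x,v)=\inf\Big\{\int_t^T\Big(\frac\varepsilon2|\ddot\gamma(s)|^2+L_0(\gamma(s),\dot\gamma(s),m^\varepsilon_s)\Big)ds+g(\gamma(T),m^\varepsilon_T)\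 :\ \gamma\in H^2(0,T;\mathbb R^d),\ \gamma(t)=x,\ \dot\gamma(t)=v\Big\};$$ and there is a flow $\Phi$, defined for $\mu_0$-a.e. $(x,v)$, such that $t\mapsto\Phi_t(x,v)$ is a Carathéodory solution on $[0,T]$, starting from $(x,v)$ at time $0$, of $$\dot\gamma(t)=v(t),\qquad \dot v(t)=-\frac1\varepsilon D_vu^\varepsilon(t,\gamma(t),v(t))$$ (in particular $D_vu^\varepsilon(t,\gamma(t),v(t))$ exists for a.e. $t$), and such that $\mu^\varepsilon_t=\Phi_t\sharp\mu_0$ for every $t\in[0,T]$. Then: 1. there is a constant $C$ such that $\int_{\mathbb R^d}|x|^2\,m^\varepsilon_t(dx)\le C$ for all $\varepsilon>0$ and all $t\in[0,T]$; 2. the family $\{m^\varepsilon_t:\varepsilon>0,\ t\in[0,T]\}$ is tight; 3. every sequence of positive numbers $\varepsilon_n\to0$ has a subsequence $\varepsilon_{n_k}$ for which there is $m^0\in C([0,T];\mathcal P_1(\mathbb R^d))$ with $m^{\varepsilon_{n_k}}\to m^0$ in $C([0,T];\mathcal P_1(\mathbb R^d))$, that is, $\sup_{t\in[0,T]}d_1(m^{\varepsilon_{n_k}}_t,m^0_t)\to0$.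 In particular there is a sequence $\varepsilon_k\downarrow0$ along which $m^{\varepsilon_k}$ converges in $C([0,T];\mathcal P_1(\mathbb R^d))$. -/

import Mathlib

open Set Filter Topology MeasureTheory

noncomputable section

namespace MFG

/-- The Euclidean space `ℝ^d`. -/
abbrev Rd (d : ℕ) : Type := EuclideanSpace ℝ (Fin d)

/-- `𝒫₁(X)`: Borel probability measures on `X` with finite first moment. -/
def P1 (X : Type*) [NormedAddCommGroup X] [MeasurableSpace X] : Type _ :=
  {m : ProbabilityMeasure X // Integrable (fun x => ‖x‖) (m : Measure X)}

/-- The measure underlying an element of `𝒫₁(X)`. -/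
def P1.toMeasure {X : Type*} [NormedAddCommGroup X] [MeasurableSpace X] (m : P1 X) : Measure X :=
  (m.1 : Measure X)

/-- `lam` is a transport plan between `m` and `m'`. Its marginals being probability measures,
it is a probability measure itself. -/
def IsPlan {X : Type*} [MeasurableSpace X] (m m' : Measure X) (lam : Measure (X × X)) : Prop :=
  lam.map Prod.fst = m ∧ lam.map Prod.snd = m'

/-- The Wasserstein distance of order one on `𝒫₁(X)`: the infimum of the transport cost over all
transport plans. For measures with finite first moment the product measure is a plan and the
distance function is integrable with respect to every plan (for separable `X`). -/
def d1 {X : Type*} [NormedAddCommGroup X] [MeasurableSpace X] (m m' : P1 X) : ℝ :=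
  sInf {c : ℝ | ∃ lam : Measure (X × X),
    IsPlan m.toMeasure m'.toMeasure lam ∧ c = ∫ p, dist p.1 p.2 ∂lam}

/-- The space marginal `π₁ ♯ μ` of `μ ∈ 𝒫₁(ℝ^d × ℝ^d)`, as an element of `𝒫₁(ℝ^d)`. -/
def spaceMarginal {d : ℕ} (μ : P1 (Rd d × Rd d)) : P1 (Rd d) :=
  ⟨μ.1.map (f := Prod.fst) measurable_fst.aemeasurable, by
    have h : Integrable (fun z : Rd d × Rd d => ‖z.1‖) (μ.1 : Measure (Rd d × Rd d)) :=
      μ.2.mono (measurable_fst.norm.aestronglyMeasurable)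
        (Eventually.of_forall fun z => by simpa using norm_fst_le z)
    have hm : ((μ.1.map (f := Prod.fst) measurable_fst.aemeasurable :
        ProbabilityMeasure (Rd d)) : Measure (Rd d))
        = (μ.1 : Measure (Rd d × Rd d)).map Prod.fst := rfl
    rw [hm]
    exact (integrable_map_measure (continuous_norm.aestronglyMeasurable)
      measurable_fst.aemeasurable).2 h⟩

/-- `m ∈ C([0,T]; 𝒫₁(X))`, with `𝒫₁(X)` metrized by `d1`
(values of `m` outside `[0,T]` play no role). -/
def IsContinuousFlow {X : Type*} [NormedAddCommGroup X] [MeasurableSpace X]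
    (T : ℝ) (m : ℝ → P1 X) : Prop :=
  ∀ t ∈ Icc (0 : ℝ) T, Tendsto (fun s => d1 (m s) (m t)) (𝓝[Icc 0 T] t) (𝓝 0)

/-- Convergence of flows in `C([0,T]; 𝒫₁(X))`, i.e. uniformly on `[0,T]` with respect to `d1`. -/
def FlowTendsto {X : Type*} [NormedAddCommGroup X] [MeasurableSpace X]
    (T : ℝ) (m : ℕ → ℝ → P1 X) (m₀ : ℝ → P1 X) : Prop :=
  ∀ η > 0, ∀ᶠ k in atTop, ∀ t ∈ Icc (0 : ℝ) T, d1 (m k t) (m₀ t) < η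

/-- `L₀` is (jointly) continuous on `ℝ^d × ℝ^d × 𝒫₁(ℝ^d)` and of class `C¹` in `(x,v)`. -/
structure LagrangianRegular {d : ℕ} (L₀ : Rd d → Rd d → P1 (Rd d) → ℝ) : Prop where
  continuous : ∀ x v m, ∀ η > 0, ∃ δ > 0, ∀ x' v' m',
    dist x' x < δ → dist v' v < δ → d1 m' m < δ → |L₀ x' v' m' - L₀ x v m| < η
  contDiff : ∀ m, ContDiff ℝ 1 (fun z : Rd d × Rd d => L₀ z.1 z.2 m)

/-- Uniform convexity in the velocity, and the growth of the first derivatives. Since `L₀` is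
only of class `C¹`, the bound `D²_v L₀ ≥ M₀⁻¹ Id` is understood in the usual weak sense:
`v ↦ L₀(x,v,m) - |v|² / (2 M₀)` is convex. For `C²` functions this is the pointwise bound. -/
structure LagrangianGrowth {d : ℕ} (M₀ : ℝ) (L₀ : Rd d → Rd d → P1 (Rd d) → ℝ) : Prop where
  convex : ∀ x m, StrongConvexOn univ (1 / M₀) (fun v => L₀ x v m)
  grad_x : ∀ x v m, ‖gradient (fun y => L₀ y v m) x‖ ≤ M₀ * (1 + ‖v‖ ^ 2)
  grad_v : ∀ x v m, ‖gradient (fun w => L₀ x w m) v‖ ≤ M₀ * (1 + ‖v‖)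

/-- Continuity of `L₀` in the measure: `|L₀(x,v,m₁) - L₀(x,v,m₂)| ≤ θ(|x|) ω₀(d₁(m₁,m₂))`. -/
def LagrangianModulus {d : ℕ} (L₀ : Rd d → Rd d → P1 (Rd d) → ℝ) : Prop :=
  ∃ θ ω₀ : ℝ → ℝ,
    (∀ r ≥ 0, 0 ≤ θ r) ∧ MonotoneOn θ (Ici 0) ∧
    (∀ r ≥ 0, 0 ≤ ω₀ r) ∧ MonotoneOn ω₀ (Ici 0) ∧ ω₀ 0 = 0 ∧ Tendsto ω₀ (𝓝[≥] 0) (𝓝 0) ∧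
    ∀ x v m₁ m₂, |L₀ x v m₁ - L₀ x v m₂| ≤ θ ‖x‖ * ω₀ (d1 m₁ m₂)

/-- The initial distribution: a probability measure on `ℝ^d × ℝ^d`, absolutely continuous with
respect to the Lebesgue measure, with compact support. -/
structure InitialDatum {d : ℕ} (μ₀ : Measure (Rd d × Rd d)) : Prop where
  isProbabilityMeasure : IsProbabilityMeasure μ₀
  absolutelyContinuous : μ₀ ≪ volume
  isCompact_support : IsCompact μ₀.support

/-- The terminal cost: `g(·,m) ∈ C¹_b` (bounded, with bounded uniformly continuous gradient),
`M₀ ≥ max {1/2, ‖Dg(·,m)‖_∞ / 2}`, and `g(x,·)` is uniformly continuous on `𝒫₁(ℝ^d)`. -/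
structure TerminalCost {d : ℕ} (M₀ : ℝ) (g : Rd d → P1 (Rd d) → ℝ) : Prop where
  contDiff : ∀ m, ContDiff ℝ 1 (fun x => g x m)
  bounded : ∀ m, ∃ C, ∀ x, |g x m| ≤ C
  grad_uniformContinuous : ∀ m, UniformContinuous (gradient (fun x => g x m))
  half_le : 1 / 2 ≤ M₀
  grad_le : ∀ m x, 1 / 2 * ‖gradient (fun y => g y m) x‖ ≤ M₀
  uniformContinuous : ∀ x, ∀ η > 0, ∃ δ > 0, ∀ m₁ m₂, d1 m₁ m₂ < δ → |g x m₁ - g x m₂| < η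

/-- `γ ∈ H²(0,T; ℝ^d)`, with (continuous) derivative `w` and weak second derivative
`α ∈ L²(0,T; ℝ^d)`. -/
structure IsH2Curve {d : ℕ} (T : ℝ) (γ w α : ℝ → Rd d) : Prop where
  hasDeriv : ∀ s ∈ Icc (0 : ℝ) T, HasDerivWithinAt γ (w s) (Icc 0 T) s
  memLp : MemLp α 2 (volume.restrict (Icc (0 : ℝ) T))
  integral : ∀ s ∈ Icc (0 : ℝ) T, w s = w 0 + ∫ r in (0 : ℝ)..s, α r

/-- The cost `∫_t^T (ε/2 |γ̈|² + L₀(γ, γ̇, m_s)) ds + g(γ(T), m_T)` of a curve `γ ∈ H²(0,T; ℝ^d)`,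
where `w = γ̇` and `α = γ̈`. -/
def cost {d : ℕ} (ε T : ℝ) (L₀ : Rd d → Rd d → P1 (Rd d) → ℝ) (g : Rd d → P1 (Rd d) → ℝ)
    (m : ℝ → P1 (Rd d)) (t : ℝ) (γ w α : ℝ → Rd d) : ℝ :=
  (∫ s in t..T, (ε / 2 * ‖α s‖ ^ 2 + L₀ (γ s) (w s) (m s))) + g (γ T) (m T)

/-- `u` is the value function of the problem of control of acceleration: `u(t,x,v)` is the
infimum of the cost over the curves with `γ(t) = x`, `γ̇(t) = v`. (Curves that are not in `H²`
have infinite cost and do not contribute to the infimum.) -/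
def IsValueFunction {d : ℕ} (ε T : ℝ) (L₀ : Rd d → Rd d → P1 (Rd d) → ℝ)
    (g : Rd d → P1 (Rd d) → ℝ) (m : ℝ → P1 (Rd d)) (u : ℝ → Rd d → Rd d → ℝ) : Prop :=
  ∀ t ∈ Icc (0 : ℝ) T, ∀ x v, IsGLB
    {c : ℝ | ∃ γ w α, IsH2Curve T γ w α ∧ γ t = x ∧ w t = v ∧ c = cost ε T L₀ g m t γ w α}
    (u t x v)

/-- `(γ, w)` solves `γ̇ = w`, `ẇ = - ε⁻¹ D_v u(t, γ, w)` on `[0,T]` with `γ(0) = x`, `w(0) = v`,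
in the sense of Carathéodory; in particular `D_v u(t, γ(t), w(t))` exists for a.e. `t`. -/
structure IsFlowCurve {d : ℕ} (ε T : ℝ) (u : ℝ → Rd d → Rd d → ℝ) (x v : Rd d)
    (γ w : ℝ → Rd d) : Prop where
  init : γ 0 = x
  hasDeriv : ∀ t ∈ Icc (0 : ℝ) T, HasDerivWithinAt γ (w t) (Icc 0 T) t
  differentiable : ∀ᵐ s ∂(volume.restrict (Icc (0 : ℝ) T)),
    DifferentiableAt ℝ (fun y => u s (γ s) y) (w s)
  integrable : IntervalIntegrable (fun s => gradient (fun y => u s (γ s) y) (w s)) volume 0 T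
  integral : ∀ t ∈ Icc (0 : ℝ) T,
    w t = v - (1 / ε) • ∫ s in (0 : ℝ)..t, gradient (fun y => u s (γ s) y) (w s)

/-- `(u, μ)` is a solution of the mean field game system with control of acceleration, with
parameter `ε`: `u ∈ W^{1,∞}_loc([0,T] × ℝ^{2d})` (i.e. `u` is locally Lipschitz) and
`μ ∈ C([0,T]; 𝒫₁(ℝ^{2d}))`; `u` is the value function for the space marginals `m_t = π₁ ♯ μ_t`;
and `μ_t` is, for every `t`, the image of `μ₀` under a flow `Φ` of
`ẋ = v`, `v̇ = - ε⁻¹ D_v u(t,x,v)`, defined for `μ₀`-almost every initial point. -/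
structure IsSolution {d : ℕ} (ε T : ℝ) (L₀ : Rd d → Rd d → P1 (Rd d) → ℝ)
    (g : Rd d → P1 (Rd d) → ℝ) (μ₀ : Measure (Rd d × Rd d))
    (u : ℝ → Rd d → Rd d → ℝ) (μ : ℝ → P1 (Rd d × Rd d)) : Prop where
  locallyLipschitz : LocallyLipschitzOn (Icc (0 : ℝ) T ×ˢ univ)
    (fun p : ℝ × Rd d × Rd d => u p.1 p.2.1 p.2.2)
  continuousFlow : IsContinuousFlow T μ
  value : IsValueFunction ε T L₀ g (fun s => spaceMarginal (μ s)) u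
  flow : ∃ Φ : ℝ → Rd d × Rd d → Rd d × Rd d,
    (∀ᵐ z ∂μ₀, IsFlowCurve ε T u z.1 z.2 (fun t => (Φ t z).1) (fun t => (Φ t z).2)) ∧
    ∀ t ∈ Icc (0 : ℝ) T, AEMeasurable (Φ t) μ₀ ∧ (μ t).toMeasure = μ₀.map (Φ t)

end MFG

end

/-!
The heart of the matter is a bound on the kinetic energy `∫ |γ̇|²` of the curves of the flow that
does not depend on `ε`. It confines the measures `m ε t` to a fixed ball and makes the curves
uniformly Hölder continuous of exponent `1/2`; since the `m ε t` are the laws of the positions of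
these curves, the moment bound and the tightness are immediate, and the compactness in
`C([0,T]; 𝒫₁)` is an Arzelà–Ascoli argument.

*Energy.* The Lagrangian is coercive in the velocity, but only relative to `L₀ x 0 m`, which has no
bound uniform in `m`. So the action of a curve is compared with the action of the curve that rests
at its starting point, for the same flow of measures: it exceeds the latter by a multiple of the
kinetic energy up to a constant (`action_ge`), whereas the value function exceeds it by a constant
at most, as the straight line, whose acceleration vanishes, shows
(`IsValueFunction.le_action_rest`). The energy bound (`IsFlowCurve.energy_le`) follows once the
curves of the flow are known to be optimal.

*Optimality* (`IsFlowCurve.action_le`). The value `u(t, γ t, w t)` along a curve of the flow is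
absolutely continuous, and it has to be shown that its derivative is at most `-L₀`. At almost every
time `D_v u` exists, and it determines the initial behaviour of *almost* optimal curves: perturbing
their initial velocity by `y` during a time `r` changes the cost, to first order, by
`-ε ⟪a, y⟫`, where `a` is their mean acceleration on `[t, t + r]`
(`IsValueFunction.le_perturb`), so `a` is close to `-ε⁻¹ D_v u`
(`IsValueFunction.eventually_norm_vel_sub_le`). The curve of the flow has the same acceleration.
Hence it stays at a distance `o(r)` from a curve that is optimal up to `r²`, along which the value
decreases at the rate of the cost, and `u` is locally Lipschitz
(`IsValueFunction.eventually_le_sub`). Neither the existence nor the regularity of minimizers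
enters.

*Compactness.* For measures carried by a compact set, closeness in `d1` follows from closeness of
the integrals of finitely many test functions, by an explicit transport plan
(`exists_testFunctions`). Prokhorov's theorem at rational times, together with equicontinuity in
time, then gives the convergent subsequence (`exists_flowTendsto_subsequence`).
-/

noncomputable section

namespace MFG

/-! ### Transport plans and the Wasserstein distance -/

/-- A coupling of two finite distributions of equal mass that leaves as much mass as possible on the
diagonal: what does not fit there, which is at most the `ℓ¹` distance, is coupled as a product. -/
theorem exists_coupling_matrix {ι : Type*} [Fintype ι] [DecidableEq ι] (a b : ι → ℝ)
    (ha : ∀ i, 0 ≤ a i) (hb : ∀ i, 0 ≤ b i) (hsum : ∑ i, a i = ∑ i, b i) :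
    ∃ k : ι → ι → ℝ, (∀ i j, 0 ≤ k i j) ∧ (∀ i, ∑ j, k i j = a i) ∧ (∀ j, ∑ i, k i j = b j) ∧
      ∑ i, ∑ j, (if i = j then 0 else k i j) ≤ ∑ i, |a i - b i| := by
  set c : ι → ℝ := fun i => min (a i) (b i) with hc
  set M : ℝ := ∑ i, (a i - c i) with hM
  have hM' : M = ∑ i, (b i - c i) := by
    simp only [hM, Finset.sum_sub_distrib, hsum]
  have hac : ∀ i, 0 ≤ a i - c i := fun i => sub_nonneg.2 (min_le_left _ _)
  have hbc : ∀ i, 0 ≤ b i - c i := fun i => sub_nonneg.2 (min_le_right _ _)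
  have hM0 : 0 ≤ M := Finset.sum_nonneg fun i _ => hac i
  have hrow : ∀ i, ∑ j, (a i - c i) * (b j - c j) / M = a i - c i := by
    intro i
    rw [← Finset.sum_div, ← Finset.mul_sum, ← hM']
    rcases eq_or_ne M 0 with h | h
    · have := (Finset.sum_eq_zero_iff_of_nonneg fun i _ => hac i).1 (hM.symm.trans h) i
        (Finset.mem_univ i)
      simp [h, this]
    · field_simp
  have hcol : ∀ j, ∑ i, (a i - c i) * (b j - c j) / M = b j - c j := by
    intro j
    rw [← Finset.sum_div, ← Finset.sum_mul, ← hM]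
    rcases eq_or_ne M 0 with h | h
    · have := (Finset.sum_eq_zero_iff_of_nonneg fun i _ => hbc i).1 (hM'.symm.trans h) j
        (Finset.mem_univ j)
      simp [h, this]
    · field_simp
  have hnn : ∀ i j, 0 ≤ (a i - c i) * (b j - c j) / M := fun i j =>
    div_nonneg (mul_nonneg (hac i) (hbc j)) hM0
  refine ⟨fun i j => (if i = j then c i else 0) + (a i - c i) * (b j - c j) / M, ?_, ?_, ?_, ?_⟩
  · intro i j
    refine add_nonneg ?_ (hnn i j)
    split_ifs
    · exact le_min (ha i) (hb i)
    · exact le_rfl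
  · intro i
    rw [Finset.sum_add_distrib, hrow]; simp
  · intro j
    rw [Finset.sum_add_distrib, hcol]; simp
  · refine Finset.sum_le_sum fun i _ => ?_
    calc ∑ j, (if i = j then 0 else (if i = j then c i else 0) + (a i - c i) * (b j - c j) / M)
        ≤ ∑ j, (a i - c i) * (b j - c j) / M := by
          refine Finset.sum_le_sum fun j _ => ?_
          split_ifs
          · exact hnn i j
          · simp
      _ = a i - c i := hrow i
      _ ≤ |a i - b i| := by
          simp only [hc]
          rcases le_total (a i) (b i) with h | h
          · simp [h]
          · simp [h, le_abs_self]

section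
variable {X : Type*} [NormedAddCommGroup X] [MeasurableSpace X]

theorem P1.isProbabilityMeasure (m : P1 X) : IsProbabilityMeasure m.toMeasure :=
  m.1.2

theorem d1_le_of_isPlan {m m' : P1 X} {lam : Measure (X × X)}
    (h : IsPlan m.toMeasure m'.toMeasure lam) : d1 m m' ≤ ∫ p, dist p.1 p.2 ∂lam := by
  refine csInf_le ⟨0, ?_⟩ ⟨lam, h, rfl⟩
  rintro c ⟨l, -, rfl⟩
  exact integral_nonneg fun _ => dist_nonneg

theorem isPlan_prod (m m' : P1 X) :
    IsPlan m.toMeasure m'.toMeasure (m.toMeasure.prod m'.toMeasure) := by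
  have := m.isProbabilityMeasure
  have := m'.isProbabilityMeasure
  constructor
  · change Measure.fst _ = _
    simp
  · change Measure.snd _ = _
    simp

theorem d1_nonneg (m m' : P1 X) : 0 ≤ d1 m m' := by
  refine Real.sInf_nonneg ?_
  rintro c ⟨l, -, rfl⟩
  exact integral_nonneg fun _ => dist_nonneg

theorem IsPlan.integrable_dist [BorelSpace X] [SecondCountableTopology X] {m m' : P1 X}
    {lam : Measure (X × X)}
    (h : IsPlan m.toMeasure m'.toMeasure lam) : Integrable (fun p : X × X => dist p.1 p.2) lam := by
  have h1 : Integrable (fun p : X × X => ‖p.1‖) lam := by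
    have := m.2
    change Integrable _ m.toMeasure at this
    rw [← h.1] at this
    exact (integrable_map_measure continuous_norm.aestronglyMeasurable
      measurable_fst.aemeasurable).1 this
  have h2 : Integrable (fun p : X × X => ‖p.2‖) lam := by
    have := m'.2
    change Integrable _ m'.toMeasure at this
    rw [← h.2] at this
    exact (integrable_map_measure continuous_norm.aestronglyMeasurable
      measurable_snd.aemeasurable).1 this
  refine (h1.add h2).mono' (by fun_prop) (Eventually.of_forall fun p => ?_)
  rw [Real.norm_of_nonneg dist_nonneg]
  exact dist_le_norm_add_norm _ _

end

theorem d1_spaceMarginal_le {d : ℕ} (μ ν : P1 (Rd d × Rd d)) :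
    d1 (spaceMarginal μ) (spaceMarginal ν) ≤ d1 μ ν := by
  refine le_csInf ⟨_, _, isPlan_prod μ ν, rfl⟩ ?_
  rintro c ⟨l, hl, rfl⟩
  have hmeas : Measurable (fun p : (Rd d × Rd d) × (Rd d × Rd d) => (p.1.1, p.2.1)) := by fun_prop
  have hplan : IsPlan (spaceMarginal μ).toMeasure (spaceMarginal ν).toMeasure
      (l.map fun p => (p.1.1, p.2.1)) := by
    constructor
    · rw [Measure.map_map measurable_fst hmeas]
      change _ = μ.toMeasure.map Prod.fst
      rw [← hl.1, Measure.map_map measurable_fst measurable_fst]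
      rfl
    · rw [Measure.map_map measurable_snd hmeas]
      change _ = ν.toMeasure.map Prod.fst
      rw [← hl.2, Measure.map_map measurable_fst measurable_snd]
      rfl
  refine (d1_le_of_isPlan hplan).trans ?_
  rw [integral_map hmeas.aemeasurable (by fun_prop)]
  refine integral_mono_of_nonneg (Eventually.of_forall fun _ => dist_nonneg) hl.integrable_dist
    (Eventually.of_forall fun p => ?_)
  exact le_max_left _ _

/-- A finite partition of unity on a compact set, by continuous functions of small support. They are
normalized tent functions; the denominator is truncated from below so that they are defined and
continuous off the compact set as well. -/
theorem exists_partitionOfUnity {X : Type*} [MetricSpace X] {K : Set X} (hK : IsCompact K)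
    {η : ℝ} (hη : 0 < η) :
    ∃ (t : Finset X) (φ : t → BoundedContinuousFunction X ℝ), (∀ i x, 0 ≤ φ i x) ∧
      (∀ x ∈ K, ∑ i, φ i x = 1) ∧ ∀ i x y, φ i x ≠ 0 → φ i y ≠ 0 → dist x y ≤ η := by
  obtain ⟨t, -, htfin, hcov⟩ := hK.finite_cover_balls (e := η / 4) (by positivity)
  lift t to Finset X using htfin
  set ψ : t → X → ℝ := fun i x => max 0 (η / 2 - dist x i) with hψ
  have hψ0 : ∀ i x, 0 ≤ ψ i x := fun i x => le_max_left _ _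
  have hψc : ∀ i, Continuous (ψ i) := fun i => by fun_prop
  have hmax : ∀ x, 0 < max (η / 4) (∑ j, ψ j x) := fun x => lt_max_of_lt_left (by positivity)
  have hφc : ∀ i, Continuous fun x => ψ i x / max (η / 4) (∑ j, ψ j x) := fun i =>
    (hψc i).div (continuous_const.max (continuous_finsetSum _ fun i _ => hψc i))
      fun x => (hmax x).ne'
  have hφ0 : ∀ i x, 0 ≤ ψ i x / max (η / 4) (∑ j, ψ j x) := fun i x =>
    div_nonneg (hψ0 i x) (hmax x).le
  have hφ1 : ∀ i x, ‖ψ i x / max (η / 4) (∑ j, ψ j x)‖ ≤ 1 := fun i x => by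
    rw [Real.norm_of_nonneg (hφ0 i x), div_le_one (hmax x)]
    exact le_max_of_le_right (Finset.single_le_sum (f := fun j => ψ j x) (fun j _ => hψ0 j x)
      (Finset.mem_univ i))
  refine ⟨t, fun i => BoundedContinuousFunction.ofNormedAddCommGroup _ (hφc i) 1 (hφ1 i),
    hφ0, ?_, ?_⟩
  · intro x hx
    obtain ⟨i, hi, hxi⟩ := mem_iUnion₂.1 (hcov hx)
    have h1 : η / 4 ≤ ∑ j, ψ j x := by
      refine le_trans ?_ (Finset.single_le_sum (f := fun j => ψ j x) (fun j _ => hψ0 j x)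
        (Finset.mem_univ ⟨i, hi⟩))
      have : dist x i < η / 4 := hxi
      exact le_max_of_le_right (by simp only; linarith)
    simp only [BoundedContinuousFunction.coe_ofNormedAddCommGroup]
    rw [← Finset.sum_div, max_eq_right h1, div_self (by linarith)]
  · have key : ∀ (i : t) x, ψ i x / max (η / 4) (∑ j, ψ j x) ≠ 0 → dist x i ≤ η / 2 := by
      intro i x h
      by_contra hlt
      apply h
      have : ψ i x = 0 := max_eq_left (by linarith)
      rw [this, zero_div]
    intro i x y hx hy
    have h1 := key i x hx
    have h2 := key i y hy
    have := dist_triangle_right x y i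
    linarith

/-- On measures carried by a set of bounded diameter, the Wasserstein distance is controlled by the
integrals of a partition of unity, up to the diameter of its supports. -/
theorem d1_le_of_partition {X : Type*} [NormedAddCommGroup X] [MeasurableSpace X] [BorelSpace X]
    [SecondCountableTopology X] {ι : Type*} [Fintype ι] (p q : P1 X) {K : Set X} {η D : ℝ}
    (hη : 0 ≤ η) (hD : 0 ≤ D)
    (hp : p.toMeasure Kᶜ = 0) (hq : q.toMeasure Kᶜ = 0)
    (hKD : ∀ x ∈ K, ∀ y ∈ K, dist x y ≤ D)
    (φ : ι → BoundedContinuousFunction X ℝ) (h0 : ∀ i x, 0 ≤ φ i x)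
    (h1 : ∀ x ∈ K, ∑ i, φ i x = 1) (hφ : ∀ i x y, φ i x ≠ 0 → φ i y ≠ 0 → dist x y ≤ η) :
    d1 p q ≤ η + D * ∑ i, |∫ x, φ i x ∂p.toMeasure - ∫ x, φ i x ∂q.toMeasure| := by
  classical
  -- Both measures are split into the pieces `φ i • p` and `φ j • q`; the plan is a combination
  -- of products of pieces, with weights that match most of the mass of the pieces with `i = j`.
  have hpart : ∀ r : P1 X, r.toMeasure Kᶜ = 0 →
      ∃ P : ι → Measure X, (∀ i, IsFiniteMeasure (P i)) ∧ (∑ i, P i = r.toMeasure) ∧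
        (∀ i, (P i) univ = ENNReal.ofReal (∫ x, φ i x ∂r.toMeasure)) ∧
        (∀ i, ∀ᵐ x ∂P i, x ∈ K ∧ φ i x ≠ 0) ∧ ∑ i, ∫ x, φ i x ∂r.toMeasure = 1 := by
    intro r hr
    have hprob := r.isProbabilityMeasure
    have hK : ∀ᵐ x ∂r.toMeasure, x ∈ K := by rwa [ae_iff]
    have hint : ∀ i, Integrable (φ i) r.toMeasure := fun i => (φ i).integrable _
    have hlint : ∀ i, ∫⁻ x, ENNReal.ofReal (φ i x) ∂r.toMeasure
        = ENNReal.ofReal (∫ x, φ i x ∂r.toMeasure) := fun i =>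
      (ofReal_integral_eq_lintegral_ofReal (hint i) (Eventually.of_forall (h0 i))).symm
    have hm : ∀ i, Measurable fun x => ENNReal.ofReal (φ i x) := fun i => by fun_prop
    refine ⟨fun i => r.toMeasure.withDensity fun x => ENNReal.ofReal (φ i x), fun i => ?_, ?_,
      fun i => ?_, fun i => ?_, ?_⟩
    · refine isFiniteMeasure_withDensity ?_
      rw [hlint]
      exact ENNReal.ofReal_ne_top
    · have h2 : ∀ s : Finset ι, ∑ i ∈ s, r.toMeasure.withDensity (fun x => ENNReal.ofReal (φ i x))
          = r.toMeasure.withDensity fun x => ∑ i ∈ s, ENNReal.ofReal (φ i x) := by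
        intro s
        ext A hA
        rw [Measure.coe_finsetSum, Finset.sum_apply, withDensity_apply _ hA,
          lintegral_finsetSum _ fun i _ => hm i]
        simp only [withDensity_apply _ hA]
      rw [h2]
      have h3 : (fun x => ∑ i, ENNReal.ofReal (φ i x)) =ᵐ[r.toMeasure] 1 := by
        filter_upwards [hK] with x hx
        rw [← ENNReal.ofReal_sum_of_nonneg fun i _ => h0 i x, h1 x hx]
        simp
      rw [withDensity_congr_ae h3, withDensity_one]
    · rw [withDensity_apply _ MeasurableSet.univ, setLIntegral_univ, hlint]
    · rw [ae_withDensity_iff (hm i)]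
      filter_upwards [hK] with x hx hne
      refine ⟨hx, fun h => hne (by simp [h])⟩
    · rw [← integral_finsetSum _ fun i _ => hint i]
      rw [integral_congr_ae (g := fun _ => 1) (by filter_upwards [hK] with x hx using h1 x hx)]
      simp
  obtain ⟨P, hPf, hPs, hPm, hPa, hPt⟩ := hpart p hp
  obtain ⟨Q, hQf, hQs, hQm, hQa, hQt⟩ := hpart q hq
  set a : ι → ℝ := fun i => ∫ x, φ i x ∂p.toMeasure with ha
  set b : ι → ℝ := fun i => ∫ x, φ i x ∂q.toMeasure with hb
  have ha0 : ∀ i, 0 ≤ a i := fun i => integral_nonneg (h0 i)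
  have hb0 : ∀ i, 0 ≤ b i := fun i => integral_nonneg (h0 i)
  obtain ⟨k, hk0, hka, hkb, hkd⟩ := exists_coupling_matrix a b ha0 hb0 (hPt.trans hQt.symm)
  have hka0 : ∀ i j, a i = 0 → k i j = 0 := fun i j h =>
    (Finset.sum_eq_zero_iff_of_nonneg fun j _ => hk0 i j).1 ((hka i).trans h) j (Finset.mem_univ j)
  have hkb0 : ∀ i j, b j = 0 → k i j = 0 := fun i j h =>
    (Finset.sum_eq_zero_iff_of_nonneg fun i _ => hk0 i j).1 ((hkb j).trans h) i (Finset.mem_univ i)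
  set c : ι → ι → ℝ := fun i j => k i j / (a i * b j) with hc
  have hc0 : ∀ i j, 0 ≤ c i j := fun i j => div_nonneg (hk0 i j) (mul_nonneg (ha0 i) (hb0 j))
  have hcab : ∀ i j, c i j * (a i * b j) = k i j := by
    intro i j
    rcases eq_or_ne (a i) 0 with h | h
    · simp [h, hka0 i j h]
    rcases eq_or_ne (b j) 0 with h' | h'
    · simp [h', hkb0 i j h']
    simp only [hc]
    field_simp
  set lam : Measure (X × X) := ∑ i, ∑ j, ENNReal.ofReal (c i j) • (P i).prod (Q j) with hlam
  have hfst : lam.map Prod.fst = p.toMeasure := by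
    rw [← hPs, hlam, Measure.map_finset_sum measurable_fst.aemeasurable]
    refine Finset.sum_congr rfl fun i _ => ?_
    rw [Measure.map_finset_sum measurable_fst.aemeasurable]
    simp only [Measure.map_smul, Measure.map_fst_prod, hQm, smul_smul]
    rw [← Finset.sum_smul]
    rcases eq_or_ne (a i) 0 with h | h
    · have : P i = 0 := Measure.measure_univ_eq_zero.1 (by simpa [hPm] using h.le)
      simp [this]
    · have : ∑ j, ENNReal.ofReal (c i j) * ENNReal.ofReal (b j) = 1 := by
        simp only [← ENNReal.ofReal_mul (hc0 _ _)]
        rw [← ENNReal.ofReal_sum_of_nonneg fun j _ => mul_nonneg (hc0 _ _) (hb0 _)]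
        have h2 : ∑ j, c i j * b j = 1 := by
          refine mul_left_cancel₀ h ?_
          rw [mul_one, Finset.mul_sum]
          refine Eq.trans (Finset.sum_congr rfl fun j _ => ?_) (hka i)
          rw [← hcab i j]; ring
        rw [h2, ENNReal.ofReal_one]
      rw [this, one_smul]
  have hsnd : lam.map Prod.snd = q.toMeasure := by
    rw [← hQs, hlam, Finset.sum_comm, Measure.map_finset_sum measurable_snd.aemeasurable]
    refine Finset.sum_congr rfl fun j _ => ?_
    rw [Measure.map_finset_sum measurable_snd.aemeasurable]
    simp only [Measure.map_smul, Measure.map_snd_prod, hPm, smul_smul]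
    rw [← Finset.sum_smul]
    rcases eq_or_ne (b j) 0 with h | h
    · have : Q j = 0 := Measure.measure_univ_eq_zero.1 (by simpa [hQm] using h.le)
      simp [this]
    · have : ∑ i, ENNReal.ofReal (c i j) * ENNReal.ofReal (a i) = 1 := by
        simp only [← ENNReal.ofReal_mul (hc0 _ _)]
        rw [← ENNReal.ofReal_sum_of_nonneg fun i _ => mul_nonneg (hc0 _ _) (ha0 _)]
        have h2 : ∑ i, c i j * a i = 1 := by
          refine mul_left_cancel₀ h ?_
          rw [mul_one, Finset.mul_sum]
          refine Eq.trans (Finset.sum_congr rfl fun i _ => ?_) (hkb j)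
          rw [← hcab i j]; ring
        rw [h2, ENNReal.ofReal_one]
      rw [this, one_smul]
  have hplan : IsPlan p.toMeasure q.toMeasure lam := ⟨hfst, hsnd⟩
  have hbound : ∀ i j, ∀ᵐ z ∂(P i).prod (Q j), dist z.1 z.2 ≤ if i = j then η else D := by
    intro i j
    filter_upwards [Measure.quasiMeasurePreserving_fst.ae (hPa i),
      Measure.quasiMeasurePreserving_snd.ae (hQa j)] with z hz1 hz2
    split_ifs with h
    · exact hφ i _ _ hz1.2 (h ▸ hz2.2)
    · exact hKD _ hz1.1 _ hz2.1
  have hint : ∀ i j, Integrable (fun z : X × X => dist z.1 z.2) ((P i).prod (Q j)) := by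
    intro i j
    refine Integrable.of_bound (by fun_prop) (if i = j then η else D)
      ((hbound i j).mono fun z hz => ?_)
    rwa [Real.norm_of_nonneg dist_nonneg]
  have hcost : ∀ i j, ∫ z, dist z.1 z.2 ∂(P i).prod (Q j)
      ≤ a i * b j * if i = j then η else D := by
    intro i j
    refine (integral_mono_ae (hint i j) (integrable_const _) (hbound i j)).trans_eq ?_
    rw [integral_const, smul_eq_mul, Measure.real, ← univ_prod_univ, Measure.prod_prod, hPm, hQm,
      ENNReal.toReal_mul, ENNReal.toReal_ofReal (ha0 i), ENNReal.toReal_ofReal (hb0 j)]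
  have hint' : ∀ i j, Integrable (fun z : X × X => dist z.1 z.2)
      (ENNReal.ofReal (c i j) • (P i).prod (Q j)) := fun i j =>
    (hint i j).smul_measure ENNReal.ofReal_ne_top
  calc d1 p q ≤ ∫ z, dist z.1 z.2 ∂lam := d1_le_of_isPlan hplan
    _ = ∑ i, ∑ j, c i j * ∫ z, dist z.1 z.2 ∂(P i).prod (Q j) := by
        rw [hlam, integral_finsetSum_measure fun i _ =>
          integrable_finsetSum_measure.2 fun j _ => hint' i j]
        refine Finset.sum_congr rfl fun i _ => ?_
        rw [integral_finsetSum_measure fun j _ => hint' i j]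
        refine Finset.sum_congr rfl fun j _ => ?_
        rw [integral_smul_measure, ENNReal.toReal_ofReal (hc0 i j), smul_eq_mul]
    _ ≤ ∑ i, ∑ j, (k i j * η + D * if i = j then 0 else k i j) := by
        refine Finset.sum_le_sum fun i _ => Finset.sum_le_sum fun j _ => ?_
        refine (mul_le_mul_of_nonneg_left (hcost i j) (hc0 i j)).trans ?_
        rw [← mul_assoc, hcab]
        split_ifs
        · simp
        · nlinarith [hk0 i j]
    _ = η + D * ∑ i, ∑ j, (if i = j then 0 else k i j) := by
        simp only [Finset.sum_add_distrib, ← Finset.mul_sum, ← Finset.sum_mul, hka]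
        rw [show ∑ i, a i = 1 from hPt, one_mul]
    _ ≤ _ := by gcongr

/-! ### Compactness of flows of measures -/

section
variable {X : Type*} [NormedAddCommGroup X] [MeasurableSpace X] [BorelSpace X]
    [SecondCountableTopology X]

/-- On measures carried by a compact set, the Wasserstein distance is small as soon as finitely many
fixed test functions have close integrals. Convergence in `d1` can thus be read off from test
functions, and no triangle inequality for `d1` is needed. -/
theorem exists_testFunctions {K : Set X} (hK : IsCompact K) {η : ℝ} (hη : 0 < η) :
    ∃ (t : Finset X) (φ : t → BoundedContinuousFunction X ℝ) (δ : ℝ), 0 < δ ∧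
      ∀ p q : P1 X, p.toMeasure Kᶜ = 0 → q.toMeasure Kᶜ = 0 →
        (∀ i, |∫ x, φ i x ∂p.toMeasure - ∫ x, φ i x ∂q.toMeasure| ≤ δ) → d1 p q < η := by
  obtain ⟨t, φ, h0, h1, hφ⟩ := exists_partitionOfUnity hK (half_pos hη)
  set D := Metric.diam K
  have hD : 0 ≤ D := Metric.diam_nonneg
  set c : ℝ := D * (t.card + 1) + 1
  have hc : 0 < c := by positivity
  refine ⟨t, φ, η / 2 / c, by positivity, fun p q hp hq hpq => ?_⟩
  refine (d1_le_of_partition p q (half_pos hη).le hD hp hq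
    (fun x hx y hy => Metric.dist_le_diam_of_mem hK.isBounded hx hy) φ h0 h1 hφ).trans_lt ?_
  have hsum : ∑ i, |∫ x, φ i x ∂p.toMeasure - ∫ x, φ i x ∂q.toMeasure| ≤ t.card * (η / 2 / c) := by
    refine (Finset.sum_le_sum fun i _ => hpq i).trans_eq ?_
    simp
  have h2 : D * (t.card * (η / 2 / c)) < η / 2 := by
    have h3 : D * t.card < c := by simp only [c]; nlinarith
    have h4 : D * (t.card * (η / 2 / c)) = η / 2 * (D * t.card / c) := by ring
    rw [h4]
    exact mul_lt_of_lt_one_right (half_pos hη) ((div_lt_one hc).2 h3)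
  nlinarith [mul_le_mul_of_nonneg_left hsum hD]

/-- An Arzelà–Ascoli theorem for flows of measures carried by a fixed compact set, with
equicontinuity tested on bounded continuous functions. -/
theorem exists_flowTendsto_subsequence {T : ℝ} (hT : 0 ≤ T) {K : Set X} (hK : IsCompact K)
    (m : ℕ → ℝ → P1 X) (hm : ∀ k, ∀ t ∈ Icc 0 T, (m k t).toMeasure Kᶜ = 0)
    (heq : ∀ φ : BoundedContinuousFunction X ℝ, ∀ σ > 0, ∃ ρ > 0, ∀ k,
      ∀ s ∈ Icc 0 T, ∀ t ∈ Icc 0 T, |s - t| < ρ →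
      |∫ x, φ x ∂(m k s).toMeasure - ∫ x, φ x ∂(m k t).toMeasure| ≤ σ) :
    ∃ j : ℕ → ℕ, StrictMono j ∧ ∃ m₀ : ℝ → P1 X,
      IsContinuousFlow T m₀ ∧ FlowTendsto T (fun k => m (j k)) m₀ := by
  set S : Set (ProbabilityMeasure X) := {μ | μ Kᶜ = 0} with hS
  have hSc : IsCompact S := by
    have := isCompact_setOfPred_probabilityMeasure_mass_eq_compl_isCompact_le (E := X)
      (u := fun _ => 0) (K := fun _ => K) tendsto_const_nhds (fun _ => hK)
      (Or.inl inferInstance)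
    convert this using 1
    ext μ
    simp [hS]
  have hmemS : ∀ p : P1 X, p.toMeasure Kᶜ = 0 → p.1 ∈ S := fun p hp =>
    (ProbabilityMeasure.null_iff_toMeasure_null p.1 Kᶜ).2 hp
  have hSint : ∀ μ ∈ S, Integrable (fun x => ‖x‖) (μ : Measure X) := by
    intro μ hμ
    obtain ⟨R, hR⟩ := hK.isBounded.exists_norm_le
    have h0 : ∀ᵐ x ∂(μ : Measure X), x ∈ K := by
      rw [ae_iff]
      exact (ProbabilityMeasure.null_iff_toMeasure_null μ Kᶜ).1 hμ
    refine Integrable.of_bound (by fun_prop) R ?_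
    filter_upwards [h0] with x hx
    simpa using hR x hx
  have hτ : ∀ q : ℚ, max 0 (min T q) ∈ Icc 0 T := fun q =>
    ⟨le_max_left _ _, max_le hT (min_le_left _ _)⟩
  -- Weak convergence along a subsequence at a countable dense set of times.
  obtain ⟨F, -, j, hj, hF⟩ := (isCompact_univ_pi fun _ : ℚ => hSc).isSeqCompact
    (x := fun k (q : ℚ) => (m k (max 0 (min T q))).1)
    (fun k q _ => hmemS _ (hm k _ (hτ q)))
  rw [tendsto_pi_nhds] at hF
  have hFφ : ∀ (q : ℚ) (φ : BoundedContinuousFunction X ℝ),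
      Tendsto (fun k => ∫ x, φ x ∂(m (j k) (max 0 (min T q))).toMeasure) atTop
        (𝓝 (∫ x, φ x ∂(F q : Measure X))) := fun q φ =>
    (ProbabilityMeasure.tendsto_iff_forall_integral_tendsto.1 (hF q)) φ
  have hnear : ∀ t ∈ Icc 0 T, ∀ ρ > 0, ∃ q : ℚ, |max 0 (min T q) - t| < ρ := by
    intro t ht ρ hρ
    obtain ⟨q, hq1, hq2⟩ := exists_rat_btwn (show t - ρ < t + ρ by linarith)
    refine ⟨q, abs_lt.2 ⟨?_, ?_⟩⟩
    · have : min T (q : ℝ) > t - ρ := lt_min (by linarith [ht.2]) hq1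
      linarith [le_max_right 0 (min T (q : ℝ))]
    · have : max 0 (min T (q : ℝ)) < t + ρ :=
        max_lt (by linarith [ht.1]) ((min_le_right _ _).trans_lt hq2)
      linarith
  have hcauchy : ∀ t ∈ Icc 0 T, ∀ φ : BoundedContinuousFunction X ℝ,
      CauchySeq fun k => ∫ x, φ x ∂(m (j k) t).toMeasure := by
    intro t ht φ
    rw [Metric.cauchySeq_iff]
    intro σ hσ
    obtain ⟨ρ, hρ, h⟩ := heq φ (σ / 4) (by positivity)
    obtain ⟨q, hq⟩ := hnear t ht ρ hρ
    obtain ⟨N, hN⟩ := Metric.cauchySeq_iff.1 (hFφ q φ).cauchySeq (σ / 4) (by positivity)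
    refine ⟨N, fun a ha b hb => ?_⟩
    have h1 := h (j a) _ (hτ q) t ht hq
    have h2 := h (j b) _ (hτ q) t ht hq
    have h3 := hN a ha b hb
    rw [Real.dist_eq] at h3 ⊢
    rw [abs_le] at h1 h2
    rw [abs_lt] at h3 ⊢
    constructor <;> linarith
  -- At the other times the limit exists by compactness, and it does not depend on a further
  -- subsequence since the integrals of test functions are Cauchy.
  have hlim : ∀ t : ℝ, ∃ p : P1 X, t ∈ Icc 0 T → p.toMeasure Kᶜ = 0 ∧
      ∀ φ : BoundedContinuousFunction X ℝ,
        Tendsto (fun k => ∫ x, φ x ∂(m (j k) t).toMeasure) atTop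
          (𝓝 (∫ x, φ x ∂p.toMeasure)) := by
    intro t
    by_cases ht : t ∈ Icc 0 T
    · obtain ⟨μ, hμ, i, hi, hlim⟩ := hSc.isSeqCompact (x := fun k => (m (j k) t).1)
        (fun k => hmemS _ (hm _ t ht))
      refine ⟨⟨μ, hSint μ hμ⟩, fun _ =>
        ⟨(ProbabilityMeasure.null_iff_toMeasure_null μ Kᶜ).1 hμ, fun φ => ?_⟩⟩
      exact tendsto_nhds_of_cauchySeq_of_subseq (hcauchy t ht φ) hi.tendsto_atTop
        ((ProbabilityMeasure.tendsto_iff_forall_integral_tendsto.1 hlim) φ)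
    · exact ⟨m 0 0, fun h => absurd h ht⟩
  choose m₀ hm₀ using hlim
  have heq₀ : ∀ φ : BoundedContinuousFunction X ℝ, ∀ σ > 0, ∃ ρ > 0,
      ∀ s ∈ Icc 0 T, ∀ t ∈ Icc 0 T, |s - t| < ρ →
      |∫ x, φ x ∂(m₀ s).toMeasure - ∫ x, φ x ∂(m₀ t).toMeasure| ≤ σ := by
    intro φ σ hσ
    obtain ⟨ρ, hρ, h⟩ := heq φ σ hσ
    refine ⟨ρ, hρ, fun s hs t ht hst => ?_⟩
    exact le_of_tendsto (((hm₀ s hs).2 φ).sub ((hm₀ t ht).2 φ)).abs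
      (Eventually.of_forall fun k => h (j k) s hs t ht hst)
  have hunif : ∀ φ : BoundedContinuousFunction X ℝ, ∀ σ > 0, ∀ᶠ k in atTop, ∀ t ∈ Icc 0 T,
      |∫ x, φ x ∂(m (j k) t).toMeasure - ∫ x, φ x ∂(m₀ t).toMeasure| ≤ σ := by
    intro φ σ hσ
    obtain ⟨ρ, hρ, h⟩ := heq φ (σ / 4) (by positivity)
    obtain ⟨ρ', hρ', h'⟩ := heq₀ φ (σ / 4) (by positivity)
    obtain ⟨N, hNT, hNfin, hcov⟩ :=
      (isCompact_Icc (a := (0 : ℝ)) (b := T)).finite_cover_balls (lt_min hρ hρ')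
    have hev : ∀ᶠ k in atTop, ∀ s ∈ N,
        |∫ x, φ x ∂(m (j k) s).toMeasure - ∫ x, φ x ∂(m₀ s).toMeasure| < σ / 4 := by
      rw [eventually_all_finite hNfin]
      intro s hs
      have := Metric.tendsto_nhds.1 ((hm₀ s (hNT hs)).2 φ) (σ / 4) (by positivity)
      simpa only [Real.dist_eq] using this
    filter_upwards [hev] with k hk t ht
    obtain ⟨s, hs, hts⟩ := mem_iUnion₂.1 (hcov ht)
    have hts : |t - s| < min ρ ρ' := by simpa [Real.dist_eq] using hts
    have h1 := h (j k) t ht s (hNT hs) (hts.trans_le (min_le_left _ _))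
    have h2 := h' t ht s (hNT hs) (hts.trans_le (min_le_right _ _))
    have h3 := hk s hs
    rw [abs_lt] at h3
    rw [abs_le] at h1 h2 ⊢
    constructor <;> linarith
  refine ⟨j, hj, m₀, ?_, ?_⟩
  · intro t ht
    rw [Metric.tendsto_nhds]
    intro η hη
    obtain ⟨N, φ, δ, hδ, hd⟩ := exists_testFunctions hK hη
    choose ρ hρ h using fun i => heq₀ (φ i) δ hδ
    have hev : ∀ᶠ s in 𝓝[Icc 0 T] t, ∀ i, |s - t| < ρ i := by
      rw [eventually_all]
      intro i
      refine eventually_nhdsWithin_of_eventually_nhds ?_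
      filter_upwards [Metric.ball_mem_nhds t (hρ i)] with s hs
      simpa [Real.dist_eq] using hs
    filter_upwards [hev, self_mem_nhdsWithin] with s hs hsT
    rw [Real.dist_0_eq_abs, abs_of_nonneg (d1_nonneg _ _)]
    exact hd _ _ (hm₀ s hsT).1 (hm₀ t ht).1 fun i => h i s hsT t ht (hs i)
  · intro η hη
    obtain ⟨N, φ, δ, hδ, hd⟩ := exists_testFunctions hK hη
    have hev := eventually_all.2 fun i => hunif (φ i) δ hδ
    filter_upwards [hev] with k hk t ht
    exact hd _ _ (hm _ t ht) (hm₀ t ht).1 fun i => hk i t ht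

end

section
variable {d : ℕ} {M₀ : ℝ} {L₀ : Rd d → Rd d → P1 (Rd d) → ℝ} {g : Rd d → P1 (Rd d) → ℝ}

/-! ### Bounds on the Lagrangian and on the action -/

theorem abs_sub_le_of_norm_gradient_le {E : Type*} [NormedAddCommGroup E] [InnerProductSpace ℝ E]
    [CompleteSpace E] {f : E → ℝ} {s : Set E} (hs : Convex ℝ s) {C : ℝ}
    (hf : ∀ x ∈ s, DifferentiableAt ℝ f x)
    (hC : ∀ x ∈ s, ‖gradient f x‖ ≤ C) {x y : E} (hx : x ∈ s) (hy : y ∈ s) :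
    |f y - f x| ≤ C * ‖y - x‖ := by
  refine hs.norm_image_sub_le_of_norm_fderiv_le (𝕜 := ℝ) hf (fun z hz => ?_) hx hy
  rw [← toDual_gradient, LinearIsometryEquiv.norm_map]
  exact hC z hz

theorem LagrangianGrowth.abs_sub_le_pos (hG : LagrangianGrowth M₀ L₀) (hR : LagrangianRegular L₀)
    (x y v : Rd d) (m : P1 (Rd d)) :
    |L₀ y v m - L₀ x v m| ≤ M₀ * (1 + ‖v‖ ^ 2) * ‖y - x‖ := by
  refine abs_sub_le_of_norm_gradient_le (f := fun z => L₀ z v m) convex_univ (fun z _ => ?_)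
    (fun z _ => hG.grad_x z v m) (mem_univ x) (mem_univ y)
  have h := ((hR.contDiff m).differentiable one_ne_zero) (z, v)
  exact h.comp (f := fun z : Rd d => (z, v)) z (by fun_prop)

theorem LagrangianGrowth.abs_sub_le_vel (hG : LagrangianGrowth M₀ L₀) (hR : LagrangianRegular L₀)
    (hM₀ : 0 < M₀) (x : Rd d) {v w : Rd d} (m : P1 (Rd d)) {R : ℝ} (hv : ‖v‖ ≤ R) (hw : ‖w‖ ≤ R) :
    |L₀ x w m - L₀ x v m| ≤ M₀ * (1 + R) * ‖w - v‖ := by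
  refine abs_sub_le_of_norm_gradient_le (f := fun z => L₀ x z m)
    (s := Metric.closedBall 0 R) (convex_closedBall _ _) (fun z _ => ?_)
    (fun z hz => ?_) (by simpa using hv) (by simpa using hw)
  · have h := ((hR.contDiff m).differentiable one_ne_zero) (x, z)
    exact h.comp (f := fun z : Rd d => (x, z)) z (by fun_prop)
  · have hz : ‖z‖ ≤ R := by simpa using hz
    exact (hG.grad_v x z m).trans (by gcongr)

/-- Coercivity of the Lagrangian, relative to its value at a base point and velocity zero. The
value at the base point is kept since it is not bounded uniformly in the measure. -/
theorem LagrangianGrowth.le_apply (hG : LagrangianGrowth M₀ L₀) (hR : LagrangianRegular L₀)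
    (hM₀ : 0 < M₀) (x y w : Rd d) (m : P1 (Rd d)) :
    L₀ x 0 m - M₀ * ‖y - x‖ - M₀ * ‖w‖ + ‖w‖ ^ 2 / (4 * M₀) ≤ L₀ y w m := by
  -- Strong convexity between `0`, `s • w` and `w`. With this value of `s` the two quadratic
  -- terms `M₀ s ‖w‖²` and `s ‖w‖² / (2 M₀)` add up to half of the gain `‖w‖² / (2 M₀)`.
  set s : ℝ := 1 / (4 * M₀ ^ 2 + 2) with hs
  have hden : 0 < 4 * M₀ ^ 2 + 2 := by positivity
  have hs0 : 0 < s := by positivity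
  have hs1 : s ≤ 1 := by
    rw [hs, div_le_one hden]; nlinarith [sq_nonneg M₀]
  have hconv := (hG.convex y m).2 (mem_univ (0 : Rd d)) (mem_univ w) (sub_nonneg.2 hs1) hs0.le
    (by ring)
  simp only [smul_zero, zero_add, zero_sub, norm_neg, smul_eq_mul] at hconv
  have hsw : ‖s • w‖ = s * ‖w‖ := by rw [norm_smul, Real.norm_of_nonneg hs0.le]
  have hv := hG.abs_sub_le_vel hR hM₀ y (v := 0) (w := s • w) m (R := s * ‖w‖)
    (by simp; positivity) hsw.le
  rw [sub_zero, hsw] at hv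
  have hx := hG.abs_sub_le_pos hR x y 0 m
  simp only [norm_zero] at hx
  rw [abs_le] at hv hx
  have h1 : s * (L₀ y 0 m - M₀ * ‖w‖ + ‖w‖ ^ 2 / (4 * M₀)) ≤ s * L₀ y w m := by
    have e1 : s * (‖w‖ ^ 2 / (4 * M₀))
        = (1 - s) * s * (1 / M₀ / 2 * ‖w‖ ^ 2) - M₀ * s ^ 2 * ‖w‖ ^ 2 := by
      rw [hs]; field_simp; ring
    nlinarith [hv.1]
  have h2 := le_of_mul_le_mul_left h1 hs0
  nlinarith [hx.1]

theorem TerminalCost.abs_sub_le (hg : TerminalCost M₀ g) (x y : Rd d) (m : P1 (Rd d)) :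
    |g y m - g x m| ≤ 2 * M₀ * ‖y - x‖ := by
  refine abs_sub_le_of_norm_gradient_le (f := fun z => g z m) convex_univ
    (fun z _ => (hg.contDiff m).differentiable one_ne_zero z) (fun z _ => ?_)
    (mem_univ x) (mem_univ y)
  linarith [hg.grad_le m z]

theorem LagrangianRegular.continuousOn_comp (hR : LagrangianRegular L₀) {T : ℝ}
    {m : ℝ → P1 (Rd d)} (hm : IsContinuousFlow T m) {γ w : ℝ → Rd d}
    (hγ : ContinuousOn γ (Icc 0 T)) (hw : ContinuousOn w (Icc 0 T)) :
    ContinuousOn (fun s => L₀ (γ s) (w s) (m s)) (Icc 0 T) := by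
  intro t ht
  rw [ContinuousWithinAt, Metric.tendsto_nhds]
  intro η hη
  obtain ⟨δ, hδ, h⟩ := hR.continuous (γ t) (w t) (m t) η hη
  filter_upwards [Metric.tendsto_nhds.1 (hγ t ht) δ hδ, Metric.tendsto_nhds.1 (hw t ht) δ hδ,
    Metric.tendsto_nhds.1 (hm t ht) δ hδ] with s h1 h2 h3
  rw [Real.dist_0_eq_abs, abs_of_nonneg (d1_nonneg _ _)] at h3
  exact h _ _ _ h1 h2 h3

theorem IsContinuousFlow.spaceMarginal {T : ℝ} {μ : ℝ → P1 (Rd d × Rd d)}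
    (hμ : IsContinuousFlow T μ) : IsContinuousFlow T fun s => spaceMarginal (μ s) := fun t ht =>
  squeeze_zero (fun _ => d1_nonneg _ _) (fun _ => d1_spaceMarginal_le _ _) (hμ t ht)

/-- The Cauchy–Schwarz inequality against the constant function `1`. -/
theorem sq_norm_integral_le {E : Type*} [NormedAddCommGroup E] [NormedSpace ℝ E] {f : ℝ → E}
    {a b : ℝ} (hab : a ≤ b) (hf : IntervalIntegrable f volume a b)
    (hf2 : IntervalIntegrable (fun s => ‖f s‖ ^ 2) volume a b) :
    ‖∫ s in a..b, f s‖ ^ 2 ≤ (b - a) * ∫ s in a..b, ‖f s‖ ^ 2 := by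
  rcases hab.eq_or_lt with rfl | hlt
  · simp
  have hba : 0 < b - a := sub_pos.2 hlt
  set I := ∫ s in a..b, ‖f s‖
  have hI : ‖∫ s in a..b, f s‖ ≤ I := intervalIntegral.norm_integral_le_integral_norm hab
  have h0 : 0 ≤ ∫ s in a..b, (‖f s‖ - I / (b - a)) ^ 2 :=
    intervalIntegral.integral_nonneg hab fun s _ => sq_nonneg _
  have h1 : ∫ s in a..b, (‖f s‖ - I / (b - a)) ^ 2
      = (∫ s in a..b, ‖f s‖ ^ 2) - 2 * (I / (b - a)) * I + (I / (b - a)) ^ 2 * (b - a) := by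
    have : ∀ s, (‖f s‖ - I / (b - a)) ^ 2
        = ‖f s‖ ^ 2 - 2 * (I / (b - a)) * ‖f s‖ + (I / (b - a)) ^ 2 := fun s => by ring
    simp only [this]
    rw [intervalIntegral.integral_add (hf2.sub (hf.norm.const_mul _)) intervalIntegrable_const,
      intervalIntegral.integral_sub hf2 (hf.norm.const_mul _),
      intervalIntegral.integral_const_mul, intervalIntegral.integral_const, smul_eq_mul]
    ring
  rw [h1] at h0
  have h2 : (b - a) * ((∫ s in a..b, ‖f s‖ ^ 2) - 2 * (I / (b - a)) * I
      + (I / (b - a)) ^ 2 * (b - a)) = (b - a) * (∫ s in a..b, ‖f s‖ ^ 2) - I ^ 2 := by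
    field_simp; ring
  have h3 := mul_nonneg hba.le h0
  rw [h2] at h3
  have h4 := pow_le_pow_left₀ (norm_nonneg _) hI 2
  linarith

theorem intervalIntegrable_of_continuousOn_Icc {E : Type*} [NormedAddCommGroup E] {T a b : ℝ}
    {f : ℝ → E} (hf : ContinuousOn f (Icc 0 T)) (ha : a ∈ Icc 0 T) (hb : b ∈ Icc 0 T) :
    IntervalIntegrable f volume a b :=
  (hf.mono (uIcc_subset_Icc ha hb)).intervalIntegrable

theorem sub_eq_integral_of_hasDerivWithinAt {E : Type*} [NormedAddCommGroup E] [NormedSpace ℝ E]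
    [CompleteSpace E] {T : ℝ} {γ w : ℝ → E}
    (hγ : ∀ s ∈ Icc (0 : ℝ) T, HasDerivWithinAt γ (w s) (Icc 0 T) s)
    (hw : ContinuousOn w (Icc 0 T)) {a b : ℝ} (ha : a ∈ Icc 0 T) (hb : b ∈ Icc 0 T) :
    ∫ s in a..b, w s = γ b - γ a := by
  have hsub : uIcc a b ⊆ Icc 0 T := uIcc_subset_Icc ha hb
  refine intervalIntegral.integral_eq_sub_of_hasDeriv_right
    (fun s hs => ((hγ s (hsub hs)).mono hsub).continuousWithinAt) (fun s hs => ?_)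
    (intervalIntegrable_of_continuousOn_Icc hw ha hb)
  have hs' : s ∈ Ioo 0 T := ⟨(le_min ha.1 hb.1).trans_lt hs.1, hs.2.trans_le (max_le ha.2 hb.2)⟩
  exact ((hγ s (Ioo_subset_Icc_self hs')).hasDerivAt
    (Icc_mem_nhds hs'.1 hs'.2)).hasDerivWithinAt

/-- The action of a curve, bounded below in terms of its kinetic energy and the action of the
resting curve at its starting point. -/
theorem action_ge (hR : LagrangianRegular L₀) (hG : LagrangianGrowth M₀ L₀)
    (hg : TerminalCost M₀ g) (hM₀ : 0 < M₀) {T t : ℝ} (ht : t ∈ Icc 0 T)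
    {m : ℝ → P1 (Rd d)} (hm : IsContinuousFlow T m) {γ w : ℝ → Rd d}
    (hγ : ∀ s ∈ Icc (0 : ℝ) T, HasDerivWithinAt γ (w s) (Icc 0 T) s)
    (hw : ContinuousOn w (Icc 0 T)) :
    (∫ s in t..T, L₀ (γ t) 0 (m s)) + g (γ t) (m T) + 1 / (8 * M₀) * (∫ s in t..T, ‖w s‖ ^ 2)
      - 2 * M₀ * (M₀ * (T + 3)) ^ 2 * T
      ≤ (∫ s in t..T, L₀ (γ s) (w s) (m s)) + g (γ T) (m T) := by
  have hT0 : 0 ≤ T := ht.1.trans ht.2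
  have hTT : T ∈ Icc 0 T := ⟨hT0, le_rfl⟩
  have hγc : ContinuousOn γ (Icc 0 T) := fun s hs => (hγ s hs).continuousWithinAt
  set I := ∫ s in t..T, ‖w s‖ with hI
  have hwi := intervalIntegrable_of_continuousOn_Icc hw.norm ht hTT
  have hw2i : IntervalIntegrable (fun s => ‖w s‖ ^ 2) volume t T :=
    intervalIntegrable_of_continuousOn_Icc (hw.norm.pow 2) ht hTT
  have hI0 : 0 ≤ I := intervalIntegral.integral_nonneg ht.2 fun s _ => norm_nonneg _
  have hdisp : ∀ s ∈ Icc t T, ‖γ s - γ t‖ ≤ I := by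
    intro s hs
    have hs' : s ∈ Icc 0 T := ⟨ht.1.trans hs.1, hs.2⟩
    rw [← sub_eq_integral_of_hasDerivWithinAt hγ hw ht hs']
    refine (intervalIntegral.norm_integral_le_integral_norm hs.1).trans ?_
    exact intervalIntegral.integral_mono_interval le_rfl hs.1 hs.2
      (Eventually.of_forall fun _ => norm_nonneg _) hwi
  have hLi := intervalIntegrable_of_continuousOn_Icc (hR.continuousOn_comp hm hγc hw) ht hTT
  have hL0i := intervalIntegrable_of_continuousOn_Icc
    (hR.continuousOn_comp hm (γ := fun _ => γ t) (w := fun _ => 0) continuousOn_const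
      continuousOn_const) ht hTT
  have h1 : (∫ s in t..T, L₀ (γ t) 0 (m s)) - (T - t) * (M₀ * I) - M₀ * I
      + 1 / (4 * M₀) * (∫ s in t..T, ‖w s‖ ^ 2) ≤ ∫ s in t..T, L₀ (γ s) (w s) (m s) := by
    have e : (∫ s in t..T, L₀ (γ t) 0 (m s)) - (T - t) * (M₀ * I) - M₀ * I
        + 1 / (4 * M₀) * (∫ s in t..T, ‖w s‖ ^ 2)
        = ∫ s in t..T, (L₀ (γ t) 0 (m s) - M₀ * I - M₀ * ‖w s‖ + 1 / (4 * M₀) * ‖w s‖ ^ 2) := by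
      rw [intervalIntegral.integral_add ((hL0i.sub intervalIntegrable_const).sub
        (hwi.const_mul _)) (hw2i.const_mul _),
        intervalIntegral.integral_sub (hL0i.sub intervalIntegrable_const) (hwi.const_mul _),
        intervalIntegral.integral_sub hL0i intervalIntegrable_const,
        intervalIntegral.integral_const, intervalIntegral.integral_const_mul,
        intervalIntegral.integral_const_mul, smul_eq_mul]
    rw [e]
    refine intervalIntegral.integral_mono_on ht.2 (((hL0i.sub intervalIntegrable_const).sub
        (hwi.const_mul _)).add (hw2i.const_mul _)) hLi fun s hs => ?_
    refine le_trans ?_ (hG.le_apply hR hM₀ (γ t) (γ s) (w s) (m s))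
    have := mul_le_mul_of_nonneg_left (hdisp s hs) hM₀.le
    have e2 : ‖w s‖ ^ 2 / (4 * M₀) = 1 / (4 * M₀) * ‖w s‖ ^ 2 := by ring
    linarith
  have h2 : g (γ t) (m T) - 2 * M₀ * I ≤ g (γ T) (m T) := by
    have h := (abs_le.1 (hg.abs_sub_le (γ t) (γ T) (m T))).1
    have h' := mul_le_mul_of_nonneg_left (hdisp T ⟨ht.2, le_rfl⟩) (by positivity : 0 ≤ 2 * M₀)
    linarith
  -- The terms that are linear in the velocity are absorbed by half of the quadratic one.
  set c := M₀ * (T + 3) with hc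
  have h3 : c * I ≤ 1 / (8 * M₀) * (∫ s in t..T, ‖w s‖ ^ 2) + 2 * M₀ * c ^ 2 * T := by
    have : c * I ≤ ∫ s in t..T, (1 / (8 * M₀) * ‖w s‖ ^ 2 + 2 * M₀ * c ^ 2) := by
      rw [hI, ← intervalIntegral.integral_const_mul]
      refine intervalIntegral.integral_mono_on ht.2 (hwi.const_mul _)
        ((hw2i.const_mul _).add intervalIntegrable_const) fun s _ => ?_
      have e : 1 / (8 * M₀) * ‖w s‖ ^ 2 + 2 * M₀ * c ^ 2 - c * ‖w s‖
          = 1 / (8 * M₀) * (‖w s‖ - 4 * M₀ * c) ^ 2 := by field_simp; ring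
      have : 0 ≤ 1 / (8 * M₀) * (‖w s‖ - 4 * M₀ * c) ^ 2 := by positivity
      linarith
    rw [intervalIntegral.integral_add (hw2i.const_mul _) intervalIntegrable_const,
      intervalIntegral.integral_const_mul, intervalIntegral.integral_const, smul_eq_mul] at this
    have : (T - t) * (2 * M₀ * c ^ 2) ≤ 2 * M₀ * c ^ 2 * T := by
      have := ht.1
      have : 0 ≤ 2 * M₀ * c ^ 2 := by positivity
      nlinarith
    linarith
  have h4 : (T - t) * (M₀ * I) + M₀ * I + 2 * M₀ * I ≤ c * I := by
    rw [hc]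
    nlinarith [mul_nonneg hM₀.le hI0, mul_nonneg (mul_nonneg hM₀.le hI0) ht.1]
  have h5 : 1 / (4 * M₀) * (∫ s in t..T, ‖w s‖ ^ 2)
      = 1 / (8 * M₀) * (∫ s in t..T, ‖w s‖ ^ 2) + 1 / (8 * M₀) * (∫ s in t..T, ‖w s‖ ^ 2) := by
    field_simp; ring
  linarith

theorem isH2Curve_line {T : ℝ} (t : ℝ) (x v : Rd d) :
    IsH2Curve T (fun s => x + (s - t) • v) (fun _ => v) (fun _ => 0) where
  hasDeriv s _ := by
    have h := (((hasDerivAt_id s).sub_const t).smul_const v).const_add x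
    simpa using h.hasDerivWithinAt
  memLp := MemLp.zero'
  integral s _ := by simp

/-- The excess of the action of the straight line with a velocity of norm `r` over the action of
the resting curve, at most. -/
def lineExcess (M₀ T r : ℝ) : ℝ :=
  T * (M₀ * (1 + r ^ 2) * (T * r) + M₀ * (1 + r) * r) + 2 * M₀ * (T * r)

theorem lineExcess_mono (hM₀ : 0 < M₀) {T r r' : ℝ} (hT : 0 ≤ T) (hr : 0 ≤ r) (h : r ≤ r') :
    lineExcess M₀ T r ≤ lineExcess M₀ T r' := by
  unfold lineExcess
  have := hr.trans h
  gcongr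

theorem IsValueFunction.le_action_rest (hR : LagrangianRegular L₀) (hG : LagrangianGrowth M₀ L₀)
    (hg : TerminalCost M₀ g) (hM₀ : 0 < M₀) {ε T t : ℝ} (ht : t ∈ Icc 0 T)
    {m : ℝ → P1 (Rd d)} (hm : IsContinuousFlow T m) {u : ℝ → Rd d → Rd d → ℝ}
    (hu : IsValueFunction ε T L₀ g m u) (x v : Rd d) :
    u t x v ≤ (∫ s in t..T, L₀ x 0 (m s)) + g x (m T) + lineExcess M₀ T ‖v‖ := by
  have hT0 : 0 ≤ T := ht.1.trans ht.2
  have hTT : T ∈ Icc 0 T := ⟨hT0, le_rfl⟩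
  have hle := (hu t ht x v).1 ⟨_, _, _, isH2Curve_line (T := T) t x v, by simp, rfl, rfl⟩
  refine hle.trans ?_
  simp only [cost, norm_zero, ne_eq, OfNat.ofNat_ne_zero, not_false_eq_true, zero_pow, mul_zero,
    zero_add]
  have hline : ∀ s ∈ Icc t T, ‖x + (s - t) • v - x‖ ≤ T * ‖v‖ := by
    intro s hs
    rw [add_sub_cancel_left, norm_smul, Real.norm_of_nonneg (sub_nonneg.2 hs.1)]
    have := ht.1
    have := hs.2
    gcongr
    linarith
  have hL0i := intervalIntegrable_of_continuousOn_Icc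
    (hR.continuousOn_comp hm (γ := fun _ => x) (w := fun _ => 0) continuousOn_const
      continuousOn_const) ht hTT
  have hLi := intervalIntegrable_of_continuousOn_Icc
    (hR.continuousOn_comp hm (γ := fun s => x + (s - t) • v) (w := fun _ => v)
      (by fun_prop) continuousOn_const) ht hTT
  set B := M₀ * (1 + ‖v‖ ^ 2) * (T * ‖v‖) + M₀ * (1 + ‖v‖) * ‖v‖ with hB
  have h1 : ∫ s in t..T, L₀ (x + (s - t) • v) v (m s) ≤ ∫ s in t..T, (L₀ x 0 (m s) + B) := by
    refine intervalIntegral.integral_mono_on ht.2 hLi (hL0i.add intervalIntegrable_const)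
      fun s hs => ?_
    have h2 := (abs_le.1 (hG.abs_sub_le_pos hR x (x + (s - t) • v) v (m s))).2
    have h3 := (abs_le.1 (hG.abs_sub_le_vel hR hM₀ x (v := 0) (w := v) (m s) (R := ‖v‖)
      (by simp) le_rfl)).2
    rw [sub_zero] at h3
    have h4 := mul_le_mul_of_nonneg_left (hline s hs)
      (by positivity : 0 ≤ M₀ * (1 + ‖v‖ ^ 2))
    simp only [hB]
    linarith
  rw [intervalIntegral.integral_add hL0i intervalIntegrable_const,
    intervalIntegral.integral_const, smul_eq_mul] at h1
  have h2 := (abs_le.1 (hg.abs_sub_le x (x + (T - t) • v) (m T))).2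
  have h3 := mul_le_mul_of_nonneg_left (hline T ⟨ht.2, le_rfl⟩) (by positivity : 0 ≤ 2 * M₀)
  have h4 : (T - t) * B ≤ T * B := by
    have := ht.1
    have : 0 ≤ B := by positivity
    nlinarith
  unfold lineExcess
  linarith

theorem IsH2Curve.continuousOn {T : ℝ} {γ w α : ℝ → Rd d} (h : IsH2Curve T γ w α) :
    ContinuousOn γ (Icc 0 T) := fun s hs => (h.hasDeriv s hs).continuousWithinAt

theorem IsH2Curve.intervalIntegrable {T : ℝ} {γ w α : ℝ → Rd d} (h : IsH2Curve T γ w α) {a b : ℝ}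
    (ha : a ∈ Icc 0 T) (hb : b ∈ Icc 0 T) : IntervalIntegrable α volume a b := by
  have h1 : IntegrableOn α (Icc 0 T) := h.memLp.integrable one_le_two
  exact (h1.mono_set (uIcc_subset_Icc ha hb)).intervalIntegrable

theorem IsH2Curve.intervalIntegrable_sq {T : ℝ} {γ w α : ℝ → Rd d} (h : IsH2Curve T γ w α)
    {a b : ℝ} (ha : a ∈ Icc 0 T) (hb : b ∈ Icc 0 T) :
    IntervalIntegrable (fun s => ‖α s‖ ^ 2) volume a b := by
  have h1 : IntegrableOn (fun s => ‖α s‖ ^ 2) (Icc 0 T) := h.memLp.integrable_norm_pow two_ne_zero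
  exact (h1.mono_set (uIcc_subset_Icc ha hb)).intervalIntegrable

theorem IsH2Curve.sub_eq_integral {T : ℝ} {γ w α : ℝ → Rd d} (h : IsH2Curve T γ w α) {a b : ℝ}
    (ha : a ∈ Icc 0 T) (hb : b ∈ Icc 0 T) : w b - w a = ∫ s in a..b, α s := by
  have h0 : (0 : ℝ) ∈ Icc 0 T := ⟨le_rfl, ha.1.trans ha.2⟩
  rw [h.integral b hb, h.integral a ha, add_sub_add_left_eq_sub,
    intervalIntegral.integral_interval_sub_left (h.intervalIntegrable h0 hb)
      (h.intervalIntegrable h0 ha)]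

theorem IsH2Curve.continuousOn_vel {T : ℝ} {γ w α : ℝ → Rd d} (h : IsH2Curve T γ w α) :
    ContinuousOn w (Icc 0 T) := by
  rcases le_or_gt 0 T with hT | hT
  · have h0 : (0 : ℝ) ∈ Icc 0 T := ⟨le_rfl, hT⟩
    have hTT : T ∈ Icc 0 T := ⟨hT, le_rfl⟩
    have h1 := intervalIntegral.continuousOn_primitive_interval' (h.intervalIntegrable h0 hTT)
      (left_mem_uIcc)
    rw [uIcc_of_le hT] at h1
    exact (continuousOn_const.add h1).congr h.integral
  · simp [Icc_eq_empty_of_lt hT]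

/-- Energy estimate for almost optimal curves. -/
theorem IsH2Curve.energy_le (hR : LagrangianRegular L₀) (hG : LagrangianGrowth M₀ L₀)
    (hg : TerminalCost M₀ g) (hM₀ : 0 < M₀) {ε T t : ℝ} (hε : 0 < ε) (ht : t ∈ Icc 0 T)
    {m : ℝ → P1 (Rd d)} (hm : IsContinuousFlow T m) {u : ℝ → Rd d → Rd d → ℝ}
    (hu : IsValueFunction ε T L₀ g m u) {γ w α : ℝ → Rd d} (h : IsH2Curve T γ w α)
    (hcost : cost ε T L₀ g m t γ w α ≤ u t (γ t) (w t) + 1) :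
    ∫ s in t..T, ‖α s‖ ^ 2
      ≤ 2 / ε * (lineExcess M₀ T ‖w t‖ + 1 + 2 * M₀ * (M₀ * (T + 3)) ^ 2 * T) := by
  have hTT : T ∈ Icc 0 T := ⟨ht.1.trans ht.2, le_rfl⟩
  have h1 := action_ge hR hG hg hM₀ ht hm h.hasDeriv h.continuousOn_vel
  have h2 := hu.le_action_rest hR hG hg hM₀ ht hm (γ t) (w t)
  rw [cost, intervalIntegral.integral_add ((h.intervalIntegrable_sq ht hTT).const_mul _)
    (intervalIntegrable_of_continuousOn_Icc
      (hR.continuousOn_comp hm h.continuousOn h.continuousOn_vel) ht hTT),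
    intervalIntegral.integral_const_mul] at hcost
  have h3 : 0 ≤ ∫ s in t..T, ‖w s‖ ^ 2 :=
    intervalIntegral.integral_nonneg ht.2 fun s _ => by positivity
  have h4 : 0 ≤ 1 / (8 * M₀) * ∫ s in t..T, ‖w s‖ ^ 2 := by positivity
  have h5 : ε / 2 * (∫ s in t..T, ‖α s‖ ^ 2)
      ≤ lineExcess M₀ T ‖w t‖ + 1 + 2 * M₀ * (M₀ * (T + 3)) ^ 2 * T := by linarith
  calc ∫ s in t..T, ‖α s‖ ^ 2 = 2 / ε * (ε / 2 * ∫ s in t..T, ‖α s‖ ^ 2) := by field_simp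
    _ ≤ _ := by gcongr

theorem IsH2Curve.norm_vel_sub_le {T : ℝ} {γ w α : ℝ → Rd d} (h : IsH2Curve T γ w α) {t s A : ℝ}
    (ht : t ∈ Icc 0 T) (hs : s ∈ Icc t T) (hA : ∫ s in t..T, ‖α s‖ ^ 2 ≤ A) :
    ‖w s - w t‖ ≤ √((s - t) * A) := by
  have hTT : T ∈ Icc 0 T := ⟨ht.1.trans ht.2, le_rfl⟩
  have hs' : s ∈ Icc 0 T := ⟨ht.1.trans hs.1, hs.2⟩
  refine Real.le_sqrt_of_sq_le ?_
  rw [h.sub_eq_integral ht hs']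
  refine (sq_norm_integral_le hs.1 (h.intervalIntegrable ht hs')
    (h.intervalIntegrable_sq ht hs')).trans ?_
  refine mul_le_mul_of_nonneg_left (le_trans ?_ hA) (sub_nonneg.2 hs.1)
  exact intervalIntegral.integral_mono_interval le_rfl hs.1 hs.2
    (Eventually.of_forall fun _ => by positivity) (h.intervalIntegrable_sq ht hTT)

/-! ### Perturbation of the initial velocity -/

/-- The profile of a velocity perturbation: affine with value `1` at `t` until it vanishes at
`t + r`, and zero from there on. -/
def ramp (t r s : ℝ) : ℝ := max 0 (1 - (s - t) / r)

/-- The derivative of `ramp t r`. -/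
def rampDeriv (t r s : ℝ) : ℝ := (Iio (t + r)).indicator (fun _ => -1 / r) s

theorem continuous_ramp (t r : ℝ) : Continuous (ramp t r) := by
  unfold ramp; fun_prop

theorem ramp_nonneg (t r s : ℝ) : 0 ≤ ramp t r s := le_max_left _ _

theorem ramp_self (t r : ℝ) : ramp t r t = 1 := by simp [ramp]

theorem ramp_le_one {t r s : ℝ} (hr : 0 < r) (hs : t ≤ s) : ramp t r s ≤ 1 := by
  refine max_le zero_le_one ?_
  have : 0 ≤ (s - t) / r := div_nonneg (sub_nonneg.2 hs) hr.le
  linarith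

theorem ramp_eq_zero {t r s : ℝ} (hr : 0 < r) (hs : t + r ≤ s) : ramp t r s = 0 := by
  refine max_eq_left ?_
  have : 1 ≤ (s - t) / r := by rw [le_div_iff₀ hr]; linarith
  linarith

theorem norm_integral_ramp_le {t r s : ℝ} (hr : 0 < r) (hs : t ≤ s) :
    ‖∫ τ in t..s, ramp t r τ‖ ≤ r := by
  have hint : ∀ a b, IntervalIntegrable (ramp t r) volume a b := fun a b =>
    (continuous_ramp t r).intervalIntegrable a b
  have hb : ∀ b, t ≤ b → ‖∫ τ in t..b, ramp t r τ‖ ≤ b - t := by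
    intro b hb
    refine (intervalIntegral.norm_integral_le_of_norm_le_const (C := 1) fun τ hτ => ?_).trans ?_
    · rw [uIoc_of_le hb] at hτ
      rw [Real.norm_of_nonneg (ramp_nonneg _ _ _)]
      exact ramp_le_one hr hτ.1.le
    · rw [abs_of_nonneg (sub_nonneg.2 hb), one_mul]
  rcases le_total s (t + r) with h | h
  · exact (hb s hs).trans (by linarith)
  · have h0 : ∫ τ in (t + r)..s, ramp t r τ = 0 := by
      refine (intervalIntegral.integral_congr (g := fun _ => 0) fun τ hτ => ?_).trans (by simp)
      rw [uIcc_of_le h] at hτ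
      exact ramp_eq_zero hr hτ.1
    rw [← intervalIntegral.integral_add_adjacent_intervals (hint t (t + r)) (hint (t + r) s), h0,
      add_zero]
    exact (hb _ (by linarith)).trans (by linarith)

theorem intervalIntegrable_rampDeriv (t r a b : ℝ) :
    IntervalIntegrable (rampDeriv t r) volume a b :=
  ⟨(integrableOn_const (by simp)).indicator measurableSet_Iio,
    (integrableOn_const (by simp)).indicator measurableSet_Iio⟩

theorem hasDerivWithinAt_ramp {t r : ℝ} (hr : 0 < r) (s : ℝ) :
    HasDerivWithinAt (ramp t r) (rampDeriv t r s) (Ioi s) s := by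
  rcases lt_or_ge s (t + r) with h | h
  · have h1 : HasDerivAt (fun s => 1 - (s - t) / r) (-1 / r) s := by
      have := (((hasDerivAt_id s).sub_const t).div_const r).const_sub 1
      simpa [neg_div] using this
    have h2 : rampDeriv t r s = -1 / r := indicator_of_mem (show s ∈ Iio (t + r) from h) _
    rw [h2]
    refine (h1.congr_of_eventuallyEq ?_).hasDerivWithinAt
    filter_upwards [Iio_mem_nhds h] with τ hτ
    refine max_eq_right ?_
    have : (τ - t) / r ≤ 1 := by rw [div_le_one hr]; linarith [mem_Iio.1 hτ]
    linarith
  · have h2 : rampDeriv t r s = 0 :=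
      indicator_of_notMem (show s ∉ Iio (t + r) from not_lt.2 h) _
    rw [h2]
    refine (hasDerivWithinAt_const s (Ioi s) (0 : ℝ)).congr (fun τ hτ => ?_) (ramp_eq_zero hr h)
    exact ramp_eq_zero hr (h.trans (le_of_lt hτ))

theorem IsH2Curve.perturb {T : ℝ} {γ w α : ℝ → Rd d} (h : IsH2Curve T γ w α) (t : ℝ) {r : ℝ}
    (hr : 0 < r) (y : Rd d) :
    IsH2Curve T (fun s => γ s + (∫ τ in t..s, ramp t r τ) • y) (fun s => w s + ramp t r s • y)
      (fun s => α s + rampDeriv t r s • y) where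
  hasDeriv s hs := by
    have h1 := ((continuous_ramp t r).integral_hasStrictDerivAt t s).hasDerivAt.smul_const y
    exact (h.hasDeriv s hs).add h1.hasDerivWithinAt
  memLp := by
    have h1 : MemLp (fun s => rampDeriv t r s • y) 2 (volume.restrict (Icc 0 T)) := by
      have h2 : (fun s => rampDeriv t r s • y)
          = (Iio (t + r)).indicator fun _ => (-1 / r) • y := by
        ext1 s
        by_cases hs : s ∈ Iio (t + r) <;> simp [rampDeriv, hs]
      rw [h2]
      exact (memLp_const _).indicator measurableSet_Iio
    exact h.memLp.add h1
  integral s hs := by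
    have h0 : (0 : ℝ) ∈ Icc 0 T := ⟨le_rfl, hs.1.trans hs.2⟩
    have h1 : ∫ τ in (0 : ℝ)..s, rampDeriv t r τ = ramp t r s - ramp t r 0 :=
      intervalIntegral.integral_eq_sub_of_hasDeriv_right (continuous_ramp t r).continuousOn
        (fun τ _ => hasDerivWithinAt_ramp hr τ) (intervalIntegrable_rampDeriv t r 0 s)
    have h2 : IntervalIntegrable (fun τ => rampDeriv t r τ • y) volume 0 s := by
      have := intervalIntegrable_rampDeriv t r 0 s
      exact ⟨this.1.smul_const y, this.2.smul_const y⟩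
    rw [intervalIntegral.integral_add (h.intervalIntegrable h0 hs) h2,
      intervalIntegral.integral_smul_const, h1, h.integral s hs, sub_smul]
    abel

/-- Perturbing the initial velocity of an admissible curve by `y`, and interpolating linearly
back to the unperturbed velocity during a time `r`. -/
theorem IsValueFunction.le_perturb (hR : LagrangianRegular L₀) (hG : LagrangianGrowth M₀ L₀)
    (hg : TerminalCost M₀ g) (hM₀ : 0 < M₀) {ε T t : ℝ} (ht : t ∈ Icc 0 T)
    {m : ℝ → P1 (Rd d)} (hm : IsContinuousFlow T m) {u : ℝ → Rd d → Rd d → ℝ}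
    (hu : IsValueFunction ε T L₀ g m u) {γ w α : ℝ → Rd d} (h : IsH2Curve T γ w α)
    {V : ℝ} (hV : ∀ s ∈ Icc t T, ‖w s‖ ≤ V) {r : ℝ} (hr : 0 < r) (hrT : t + r ≤ T)
    {y : Rd d} (hy : ‖y‖ ≤ 1) :
    u t (γ t) (w t + y) ≤ cost ε T L₀ g m t γ w α - ε / r * inner ℝ (w (t + r) - w t) y
      + ε * ‖y‖ ^ 2 / (2 * r)
      + (2 * T * (M₀ * (1 + (V + 1) ^ 2)) + M₀ * (1 + (V + 1)) + 2 * M₀) * ‖y‖ * r := by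
  have hTT : T ∈ Icc 0 T := ⟨ht.1.trans ht.2, le_rfl⟩
  have htr : t + r ∈ Icc 0 T := ⟨by linarith [ht.1], hrT⟩
  have htr' : t ≤ t + r := by linarith
  have hV0 : 0 ≤ V := (norm_nonneg _).trans (hV t ⟨le_rfl, ht.2⟩)
  set γ' := fun s => γ s + (∫ τ in t..s, ramp t r τ) • y with hγ'
  set w' := fun s => w s + ramp t r s • y with hw'
  set α' := fun s => α s + rampDeriv t r s • y with hα'
  have h' : IsH2Curve T γ' w' α' := h.perturb t hr y
  have hle : u t (γ t) (w t + y) ≤ cost ε T L₀ g m t γ' w' α' :=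
    (hu t ht _ _).1 ⟨γ', w', α', h', by simp [hγ'], by simp [hw', ramp_self], rfl⟩
  refine hle.trans ?_
  have hdγ : ∀ s ∈ Icc t T, ‖γ' s - γ s‖ ≤ r * ‖y‖ := by
    intro s hs
    simp only [hγ', add_sub_cancel_left, norm_smul]
    exact mul_le_mul_of_nonneg_right (norm_integral_ramp_le hr hs.1) (norm_nonneg _)
  have hdw : ∀ s ∈ Icc t T, ‖w' s - w s‖ ≤ ‖y‖ := by
    intro s hs
    simp only [hw', add_sub_cancel_left, norm_smul, Real.norm_of_nonneg (ramp_nonneg _ _ _)]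
    exact mul_le_of_le_one_left (norm_nonneg _) (ramp_le_one hr hs.1)
  have hV' : ∀ s ∈ Icc t T, ‖w' s‖ ≤ V + 1 := by
    intro s hs
    have h1 := norm_le_norm_add_norm_sub' (w' s) (w s)
    linarith [hdw s hs, hV s hs]
  set C₁ := M₀ * (1 + (V + 1) ^ 2) with hC₁
  set C₂ := M₀ * (1 + (V + 1)) with hC₂
  have hC₁0 : 0 ≤ C₁ := by positivity
  have hC₂0 : 0 ≤ C₂ := by positivity
  have hpos : ∀ s ∈ Icc t T, L₀ (γ' s) (w' s) (m s) ≤ L₀ (γ s) (w' s) (m s) + C₁ * (r * ‖y‖) := by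
    intro s hs
    have h1 := (abs_le.1 (hG.abs_sub_le_pos hR (γ s) (γ' s) (w' s) (m s))).2
    have h2 : M₀ * (1 + ‖w' s‖ ^ 2) * ‖γ' s - γ s‖ ≤ C₁ * (r * ‖y‖) := by
      have := hV' s hs
      have := hdγ s hs
      rw [hC₁]
      gcongr
    linarith
  have hvel : ∀ s ∈ Icc t T, L₀ (γ s) (w' s) (m s) ≤ L₀ (γ s) (w s) (m s) + C₂ * ‖y‖ := by
    intro s hs
    have h1 := (abs_le.1 (hG.abs_sub_le_vel hR hM₀ (γ s) (v := w s) (w := w' s) (m s)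
      (R := V + 1) (by linarith [hV s hs]) (hV' s hs))).2
    have h2 := mul_le_mul_of_nonneg_left (hdw s hs) hC₂0
    linarith
  have hLi : ∀ {a b}, a ∈ Icc 0 T → b ∈ Icc 0 T →
      IntervalIntegrable (fun s => L₀ (γ s) (w s) (m s)) volume a b := fun ha hb =>
    intervalIntegrable_of_continuousOn_Icc
      (hR.continuousOn_comp hm h.continuousOn h.continuousOn_vel) ha hb
  have hLi' : ∀ {a b}, a ∈ Icc 0 T → b ∈ Icc 0 T →
      IntervalIntegrable (fun s => L₀ (γ' s) (w' s) (m s)) volume a b := fun ha hb =>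
    intervalIntegrable_of_continuousOn_Icc
      (hR.continuousOn_comp hm h'.continuousOn h'.continuousOn_vel) ha hb
  have hFi : ∀ {a b}, a ∈ Icc 0 T → b ∈ Icc 0 T →
      IntervalIntegrable (fun s => ε / 2 * ‖α s‖ ^ 2 + L₀ (γ s) (w s) (m s)) volume a b :=
    fun ha hb => ((h.intervalIntegrable_sq ha hb).const_mul _).add (hLi ha hb)
  have hFi' : ∀ {a b}, a ∈ Icc 0 T → b ∈ Icc 0 T →
      IntervalIntegrable (fun s => ε / 2 * ‖α' s‖ ^ 2 + L₀ (γ' s) (w' s) (m s)) volume a b :=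
    fun ha hb => ((h'.intervalIntegrable_sq ha hb).const_mul _).add (hLi' ha hb)
  have hαy : IntervalIntegrable (fun s => inner ℝ y (α s)) volume t (t + r) :=
    ⟨(h.intervalIntegrable ht htr).1.const_inner y, (h.intervalIntegrable ht htr).2.const_inner y⟩
  set k := ε * ‖y‖ ^ 2 / (2 * r ^ 2) + (C₁ * (r * ‖y‖) + C₂ * ‖y‖) with hk
  have hA1 : ∫ s in t..(t + r), (ε / 2 * ‖α' s‖ ^ 2 + L₀ (γ' s) (w' s) (m s))
      ≤ (∫ s in t..(t + r), (ε / 2 * ‖α s‖ ^ 2 + L₀ (γ s) (w s) (m s)))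
        - ε / r * inner ℝ (w (t + r) - w t) y + r * k := by
    have e : (∫ s in t..(t + r), (ε / 2 * ‖α s‖ ^ 2 + L₀ (γ s) (w s) (m s)))
        - ε / r * inner ℝ (w (t + r) - w t) y + r * k
        = ∫ s in t..(t + r), ((ε / 2 * ‖α s‖ ^ 2 + L₀ (γ s) (w s) (m s))
          - ε / r * inner ℝ y (α s) + k) := by
      rw [intervalIntegral.integral_add ((hFi ht htr).sub (hαy.const_mul _))
        intervalIntegrable_const, intervalIntegral.integral_sub (hFi ht htr) (hαy.const_mul _),
        intervalIntegral.integral_const_mul, intervalIntegral.integral_const, smul_eq_mul,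
        h.sub_eq_integral ht htr, add_sub_cancel_left]
      have : ∫ s in t..(t + r), inner ℝ y (α s) = inner ℝ (∫ s in t..(t + r), α s) y := by
        rw [real_inner_comm]
        exact ((innerSL ℝ y).intervalIntegral_comp_comm (h.intervalIntegrable ht htr))
      rw [this]
    rw [e]
    refine intervalIntegral.integral_mono_on_of_le_Ioo htr' (hFi' ht htr)
      (((hFi ht htr).sub (hαy.const_mul _)).add intervalIntegrable_const) fun s hs => ?_
    have hs' : s ∈ Icc t T := ⟨hs.1.le, hs.2.le.trans hrT⟩
    have hr' : rampDeriv t r s = -1 / r := indicator_of_mem (show s ∈ Iio (t + r) from hs.2) _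
    have e2 : ε / 2 * ‖α' s‖ ^ 2
        = ε / 2 * ‖α s‖ ^ 2 - ε / r * inner ℝ y (α s) + ε * ‖y‖ ^ 2 / (2 * r ^ 2) := by
      simp only [hα', hr']
      rw [norm_add_sq_real, inner_smul_right, norm_smul, mul_pow, Real.norm_eq_abs, sq_abs,
        real_inner_comm]
      field_simp
      ring
    rw [e2, hk]
    linarith [hpos s hs', hvel s hs']
  have hA2 : ∫ s in (t + r)..T, (ε / 2 * ‖α' s‖ ^ 2 + L₀ (γ' s) (w' s) (m s))
      ≤ (∫ s in (t + r)..T, (ε / 2 * ‖α s‖ ^ 2 + L₀ (γ s) (w s) (m s)))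
        + (T - (t + r)) * (C₁ * (r * ‖y‖)) := by
    have e : (∫ s in (t + r)..T, (ε / 2 * ‖α s‖ ^ 2 + L₀ (γ s) (w s) (m s)))
        + (T - (t + r)) * (C₁ * (r * ‖y‖))
        = ∫ s in (t + r)..T, ((ε / 2 * ‖α s‖ ^ 2 + L₀ (γ s) (w s) (m s)) + C₁ * (r * ‖y‖)) := by
      rw [intervalIntegral.integral_add (hFi htr hTT) intervalIntegrable_const,
        intervalIntegral.integral_const, smul_eq_mul]
    rw [e]
    refine intervalIntegral.integral_mono_on hrT (hFi' htr hTT)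
      ((hFi htr hTT).add intervalIntegrable_const) fun s hs => ?_
    have hs' : s ∈ Icc t T := ⟨htr'.trans hs.1, hs.2⟩
    have hα0 : α' s = α s := by
      simp only [hα']
      rw [show rampDeriv t r s = 0 from
        indicator_of_notMem (show s ∉ Iio (t + r) from not_lt.2 hs.1) _]
      simp
    have hw0 : w' s = w s := by simp [hw', ramp_eq_zero hr hs.1]
    have := hpos s hs'
    rw [hw0] at this ⊢
    rw [hα0]
    linarith
  have hA3 : g (γ' T) (m T) ≤ g (γ T) (m T) + 2 * M₀ * (r * ‖y‖) := by
    have h1 := (abs_le.1 (hg.abs_sub_le (γ T) (γ' T) (m T))).2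
    have h2 := mul_le_mul_of_nonneg_left (hdγ T ⟨ht.2, le_rfl⟩) (by positivity : 0 ≤ 2 * M₀)
    linarith
  simp only [cost]
  rw [← intervalIntegral.integral_add_adjacent_intervals (hFi' ht htr) (hFi' htr hTT),
    ← intervalIntegral.integral_add_adjacent_intervals (hFi ht htr) (hFi htr hTT)]
  have hk1 : r * k = ε * ‖y‖ ^ 2 / (2 * r) + r * (C₁ * (r * ‖y‖)) + C₂ * (r * ‖y‖) := by
    rw [hk]; field_simp; ring
  have hk2 : (T - (t + r)) * (C₁ * (r * ‖y‖)) + r * (C₁ * (r * ‖y‖))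
      ≤ 2 * T * C₁ * ‖y‖ * r := by
    have : 0 ≤ C₁ * (r * ‖y‖) := by positivity
    have hT0 : 0 ≤ T := hTT.1
    nlinarith [ht.1, mul_nonneg hT0 this, mul_nonneg ht.1 this]
  linarith

/-! ### Decrease of the value along the flow -/

/-- Where `u(t, x, ·)` is differentiable, all almost optimal curves leave with nearly the same
velocity increment: their mean acceleration over a short time is close to `-ε⁻¹ D_v u(t, x, v)`. -/
theorem IsValueFunction.eventually_norm_vel_sub_le (hR : LagrangianRegular L₀)
    (hG : LagrangianGrowth M₀ L₀) (hg : TerminalCost M₀ g) (hM₀ : 0 < M₀) {ε T t : ℝ}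
    (hε : 0 < ε) (ht : t ∈ Ico 0 T) {m : ℝ → P1 (Rd d)} (hm : IsContinuousFlow T m)
    {u : ℝ → Rd d → Rd d → ℝ} (hu : IsValueFunction ε T L₀ g m u) {x v p : Rd d}
    (hp : HasGradientAt (fun y => u t x y) p v) {σ : ℝ} (hσ : 0 < σ) :
    ∀ᶠ r in 𝓝[>] (0 : ℝ), ∀ γ w α : ℝ → Rd d, IsH2Curve T γ w α → γ t = x → w t = v →
      cost ε T L₀ g m t γ w α ≤ u t x v + r ^ 2 →
      ‖w (t + r) - v + (r / ε) • p‖ ≤ σ * r := by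
  have ht' : t ∈ Icc 0 T := Ico_subset_Icc_self ht
  set A := 2 / ε * (lineExcess M₀ T ‖v‖ + 1 + 2 * M₀ * (M₀ * (T + 3)) ^ 2 * T) with hA
  set V := ‖v‖ + √(T * A) with hV
  have hT0 : 0 < T := ht.1.trans_lt ht.2
  set C := 2 * T * (M₀ * (1 + (V + 1) ^ 2)) + M₀ * (1 + (V + 1)) + 2 * M₀ with hC
  have hV0 : 0 ≤ V := by positivity
  have hC0 : 0 ≤ C := by positivity
  have hlittle := (hasGradientAt_iff_isLittleO.1 hp).def (by positivity : 0 < ε * σ / 8)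
  obtain ⟨ρ, hρ, hρ'⟩ := Metric.eventually_nhds_iff.1 hlittle
  have hpos1 : 0 < 1 + C * σ := by positivity
  filter_upwards [self_mem_nhdsWithin,
    eventually_nhdsWithin_of_eventually_nhds (Iio_mem_nhds one_pos),
    eventually_nhdsWithin_of_eventually_nhds (Iio_mem_nhds (sub_pos.2 ht.2)),
    eventually_nhdsWithin_of_eventually_nhds (Iio_mem_nhds (div_pos (lt_min hρ one_pos) hσ)),
    eventually_nhdsWithin_of_eventually_nhds
      (Iio_mem_nhds (show 0 < 3 / 8 * (ε * σ ^ 2) / (1 + C * σ) by positivity))]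
    with r hr hr1 hrT hrρ hrC γ w α h hγ hw hcost
  rw [mem_Ioi] at hr
  rw [lt_div_iff₀ hσ] at hrρ
  rw [lt_div_iff₀ hpos1] at hrC
  subst hγ hw
  set D := w (t + r) - w t + (r / ε) • p with hD
  rcases eq_or_ne D 0 with h0 | h0
  · rw [h0, norm_zero]; positivity
  have hD0 : 0 < ‖D‖ := norm_pos_iff.2 h0
  have henergy := h.energy_le hR hG hg hM₀ hε ht' hm hu
    (hcost.trans (by nlinarith : u t (γ t) (w t) + r ^ 2 ≤ u t (γ t) (w t) + 1))
  have hA0 : 0 ≤ A := le_trans (intervalIntegral.integral_nonneg ht'.2 fun s _ => by positivity)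
    henergy
  have hwV : ∀ s ∈ Icc t T, ‖w s‖ ≤ V := by
    intro s hs
    have h1 := h.norm_vel_sub_le ht' hs henergy
    have h2 : √((s - t) * A) ≤ √(T * A) := by
      refine Real.sqrt_le_sqrt (mul_le_mul_of_nonneg_right ?_ hA0)
      linarith [hs.2, ht.1]
    have h3 := norm_le_norm_add_norm_sub' (w s) (w t)
    rw [hV]; linarith
  -- Test the first-order expansion of `u` with a perturbation of size `σ * r` in the direction of
  -- the deviation `D`: its error terms, of order `σ ^ 2 * r`, are small against `σ * ‖D‖` unless
  -- `‖D‖` is at most `σ * r`.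
  set y : Rd d := (σ * r / ‖D‖) • D with hy
  have hynorm : ‖y‖ = σ * r := by
    rw [hy, norm_smul, Real.norm_of_nonneg (by positivity)]
    field_simp
  have hyρ : ‖y‖ < ρ := by
    rw [hynorm, mul_comm]; exact hrρ.trans_le (min_le_left _ _)
  have hy1 : ‖y‖ ≤ 1 := by
    rw [hynorm, mul_comm]; exact (hrρ.trans_le (min_le_right _ _)).le
  have h1 := hu.le_perturb hR hG hg hM₀ ht' hm h hwV hr (by linarith) hy1
  have h2 := hρ' (y := w t + y) (by simpa [dist_eq_norm] using hyρ)
  rw [add_sub_cancel_left, hynorm, Real.norm_eq_abs, abs_le] at h2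
  have h3 : inner ℝ p y + ε / r * inner ℝ (w (t + r) - w t) y = ε * (σ * ‖D‖) := by
    have e1 : inner ℝ p y + ε / r * inner ℝ (w (t + r) - w t) y = ε / r * inner ℝ D y := by
      rw [hD, inner_add_left, real_inner_smul_left]; field_simp; ring
    rw [e1, hy, real_inner_smul_right, real_inner_self_eq_norm_sq]
    field_simp
  rw [hynorm] at h1
  have h4 : ε * (σ * r) ^ 2 / (2 * r) = ε * σ ^ 2 * r / 2 := by field_simp
  rw [h4] at h1
  have h5 : ε * σ * ‖D‖ ≤ ε * σ * (σ * r) := by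
    have h6 : r * (r * (1 + C * σ)) ≤ r * (3 / 8 * (ε * σ ^ 2)) := by gcongr
    nlinarith [h2.1]
  exact le_of_mul_le_mul_left h5 (by positivity)

theorem eventually_norm_sub_le_of_hasDerivWithinAt {E : Type*} [NormedAddCommGroup E]
    [NormedSpace ℝ E] {f : ℝ → E} {f' : E} {t : ℝ} (h : HasDerivWithinAt f f' (Ioi t) t) {σ : ℝ}
    (hσ : 0 < σ) : ∀ᶠ r in 𝓝[>] (0 : ℝ), ‖f (t + r) - f t - r • f'‖ ≤ σ * r := by
  have h1 : Tendsto (fun r : ℝ => t + r) (𝓝[>] 0) (𝓝[>] t) := by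
    refine tendsto_nhdsWithin_iff.2 ⟨?_, ?_⟩
    · have : Tendsto (fun r : ℝ => t + r) (𝓝 0) (𝓝 (t + 0)) := by
        exact (continuous_const.add continuous_id).tendsto 0
      rw [add_zero] at this
      exact this.mono_left nhdsWithin_le_nhds
    · filter_upwards [self_mem_nhdsWithin] with r hr
      simpa using hr
  have h2 := h1.eventually ((hasDerivWithinAt_iff_isLittleO.1 h).def hσ)
  filter_upwards [h2, self_mem_nhdsWithin] with r hr hr0
  rw [add_sub_cancel_left, Real.norm_of_nonneg (le_of_lt hr0)] at hr
  exact hr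

/-- Along a curve whose acceleration is `-ε⁻¹ D_v u`, the value decreases at least at the rate
`L₀`. Such a curve agrees to first order with almost optimal curves, along which the value
decreases like the cost, and `u` is locally Lipschitz. -/
theorem IsValueFunction.eventually_le_sub (hR : LagrangianRegular L₀)
    (hG : LagrangianGrowth M₀ L₀) (hg : TerminalCost M₀ g) (hM₀ : 0 < M₀) {ε T t : ℝ}
    (hε : 0 < ε) (ht : t ∈ Ico 0 T) {m : ℝ → P1 (Rd d)} (hm : IsContinuousFlow T m)
    {u : ℝ → Rd d → Rd d → ℝ} (hu : IsValueFunction ε T L₀ g m u)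
    (hlip : LocallyLipschitzOn (Icc (0 : ℝ) T ×ˢ univ)
      (fun q : ℝ × Rd d × Rd d => u q.1 q.2.1 q.2.2))
    {γ w : ℝ → Rd d} {p : Rd d}
    (hp : HasGradientAt (fun y => u t (γ t) y) p (w t))
    (hγ : HasDerivWithinAt γ (w t) (Ioi t) t)
    (hw : HasDerivWithinAt w (-((1 / ε) • p)) (Ioi t) t) {σ : ℝ} (hσ : 0 < σ) :
    ∀ᶠ r in 𝓝[>] (0 : ℝ),
      u (t + r) (γ (t + r)) (w (t + r)) ≤ u t (γ t) (w t) - r * L₀ (γ t) (w t) (m t) + σ * r := by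
  have ht' : t ∈ Icc 0 T := Ico_subset_Icc_self ht
  have hT0 : 0 < T := ht.1.trans_lt ht.2
  have hTT : T ∈ Icc 0 T := ⟨hT0.le, le_rfl⟩
  obtain ⟨K, U, hU, hK⟩ := hlip (x := (t, γ t, w t)) ⟨ht', mem_univ _⟩
  obtain ⟨ρ, hρ, hρU⟩ := Metric.mem_nhdsWithin_iff.1 hU
  set σ' := σ / (2 * (1 + 2 * K)) with hσ'
  have hσ'0 : 0 < σ' := by positivity
  have hσ'1 : σ' + 2 * K * σ' = σ / 2 := by rw [hσ']; field_simp
  obtain ⟨δ, hδ, hcont⟩ := hR.continuous (γ t) (w t) (m t) σ' hσ'0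
  set A := 2 / ε * (lineExcess M₀ T ‖w t‖ + 1 + 2 * M₀ * (M₀ * (T + 3)) ^ 2 * T) with hA
  have hmt : ∀ᶠ r in 𝓝[>] (0 : ℝ), ∀ s ∈ Icc t (t + r), d1 (m s) (m t) < δ := by
    obtain ⟨κ, hκ, hκ'⟩ := Metric.mem_nhdsWithin_iff.1 (Metric.tendsto_nhds.1 (hm t ht') δ hδ)
    filter_upwards [eventually_nhdsWithin_of_eventually_nhds (Iio_mem_nhds hκ),
      eventually_nhdsWithin_of_eventually_nhds (Iio_mem_nhds (sub_pos.2 ht.2))] with r hr hrT s hs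
    have h1 : s ∈ Metric.ball t κ ∩ Icc 0 T := by
      refine ⟨?_, ht.1.trans hs.1, by linarith [hs.2]⟩
      rw [Metric.mem_ball, Real.dist_eq, abs_of_nonneg (sub_nonneg.2 hs.1)]
      linarith [hs.2]
    have h2 := hκ' h1
    simpa only [mem_ofPred_eq, Real.dist_0_eq_abs, abs_of_nonneg (d1_nonneg _ _)] using h2
  have hsqrt : Tendsto (fun r : ℝ => √(r * A)) (𝓝[>] 0) (𝓝 0) := by
    have : Continuous fun r : ℝ => √(r * A) := by fun_prop
    have h1 := this.tendsto 0
    simp only [zero_mul, Real.sqrt_zero] at h1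
    exact h1.mono_left nhdsWithin_le_nhds
  have hlin : ∀ c : ℝ, Tendsto (fun r : ℝ => r * c) (𝓝[>] 0) (𝓝 0) := by
    intro c
    have : Continuous fun r : ℝ => r * c := by fun_prop
    have h1 := this.tendsto 0
    rw [zero_mul] at h1
    exact h1.mono_left nhdsWithin_le_nhds
  filter_upwards [self_mem_nhdsWithin,
    eventually_nhdsWithin_of_eventually_nhds (Iio_mem_nhds one_pos),
    eventually_nhdsWithin_of_eventually_nhds (Iio_mem_nhds (sub_pos.2 ht.2)),
    eventually_nhdsWithin_of_eventually_nhds (Iio_mem_nhds (half_pos hσ)),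
    hu.eventually_norm_vel_sub_le hR hG hg hM₀ hε ht hm hp hσ'0,
    eventually_norm_sub_le_of_hasDerivWithinAt hγ hσ'0,
    eventually_norm_sub_le_of_hasDerivWithinAt hw hσ'0,
    hmt, hsqrt.eventually_lt_const (lt_min hσ'0 hδ),
    (hlin (‖w t‖ + σ' + 1)).eventually_lt_const hδ,
    (hlin (‖w t‖ + ‖(1 / ε) • p‖ + 4 * σ' + 1)).eventually_lt_const hρ]
    with r hr hr1 hrT hrσ hvel hγr hwr hmr hsq hrδ hrρ
  rw [mem_Ioi] at hr
  have htr : t + r ∈ Icc 0 T := ⟨by linarith [ht.1], by linarith⟩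
  have htr' : t ≤ t + r := by linarith
  -- A curve that is optimal up to `r ^ 2`.
  obtain ⟨c, ⟨γ', w', α', h, hγ0, hw0, rfl⟩, -, hc⟩ :=
    (hu t ht' (γ t) (w t)).exists_between (show u t (γ t) (w t) < u t (γ t) (w t) + r ^ 2 by
      linarith [pow_pos hr 2])
  have hvel' := hvel γ' w' α' h hγ0 hw0 hc.le
  have henergy := h.energy_le hR hG hg hM₀ hε ht' hm hu
    (by rw [hγ0, hw0]; exact hc.le.trans (by nlinarith))
  rw [hw0] at henergy
  have hA0 : 0 ≤ A := le_trans (intervalIntegral.integral_nonneg ht'.2 fun s _ => by positivity)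
    henergy
  have hw's : ∀ s ∈ Icc t (t + r), ‖w' s - w t‖ ≤ √(r * A) := by
    intro s hs
    have h1 := h.norm_vel_sub_le ht' (s := s) ⟨hs.1, hs.2.trans htr.2⟩ henergy
    rw [hw0] at h1
    refine h1.trans (Real.sqrt_le_sqrt (mul_le_mul_of_nonneg_right ?_ hA0))
    linarith [hs.2]
  have hγ's : ∀ s ∈ Icc t (t + r), ‖γ' s - γ t - (s - t) • w t‖ ≤ r * σ' := by
    intro s hs
    have hs' : s ∈ Icc 0 T := ⟨ht.1.trans hs.1, hs.2.trans htr.2⟩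
    have e : γ' s - γ t - (s - t) • w t = ∫ τ in t..s, (w' τ - w t) := by
      rw [intervalIntegral.integral_sub
        (intervalIntegrable_of_continuousOn_Icc h.continuousOn_vel ht' hs')
        intervalIntegrable_const, intervalIntegral.integral_const,
        sub_eq_integral_of_hasDerivWithinAt h.hasDeriv h.continuousOn_vel ht' hs', hγ0]
    rw [e]
    refine (intervalIntegral.norm_integral_le_of_norm_le_const (C := σ') fun τ hτ => ?_).trans ?_
    · rw [uIoc_of_le hs.1] at hτ
      exact (hw's τ ⟨hτ.1.le, hτ.2.trans hs.2⟩).trans (hsq.le.trans (min_le_left _ _))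
    · rw [abs_of_nonneg (sub_nonneg.2 hs.1), mul_comm]
      exact mul_le_mul_of_nonneg_right (by linarith [hs.2]) hσ'0.le
  have hLi := intervalIntegrable_of_continuousOn_Icc
      (hR.continuousOn_comp hm h.continuousOn h.continuousOn_vel) ht' htr
  have hαi := (h.intervalIntegrable_sq ht' htr).const_mul (ε / 2)
  have hLint : r * (L₀ (γ t) (w t) (m t) - σ')
      ≤ ∫ s in t..(t + r), (ε / 2 * ‖α' s‖ ^ 2 + L₀ (γ' s) (w' s) (m s)) := by
    have e : r * (L₀ (γ t) (w t) (m t) - σ')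
        = ∫ s in t..(t + r), (L₀ (γ t) (w t) (m t) - σ') := by
      rw [intervalIntegral.integral_const, smul_eq_mul, add_sub_cancel_left]
    rw [e]
    refine intervalIntegral.integral_mono_on htr' intervalIntegrable_const
      (hαi.add hLi) fun s hs => ?_
    have h1 : dist (γ' s) (γ t) < δ := by
      rw [dist_eq_norm]
      have h2 : ‖γ' s - γ t‖ ≤ ‖γ' s - γ t - (s - t) • w t‖ + ‖(s - t) • w t‖ :=
        norm_le_norm_sub_add _ _
      rw [norm_smul, Real.norm_of_nonneg (sub_nonneg.2 hs.1)] at h2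
      have h3 : (s - t) * ‖w t‖ ≤ r * ‖w t‖ :=
        mul_le_mul_of_nonneg_right (by linarith [hs.2]) (norm_nonneg _)
      linarith [hγ's s hs]
    have h2 : dist (w' s) (w t) < δ := by
      rw [dist_eq_norm]
      exact (hw's s hs).trans_lt (hsq.trans_le (min_le_right _ _))
    have h3 := (abs_lt.1 (hcont _ _ _ h1 h2 (hmr s hs))).1
    have h4 : 0 ≤ ε / 2 * ‖α' s‖ ^ 2 := by positivity
    linarith
  -- The remainder of an almost optimal curve is admissible at its new starting point.
  have hdpp : u (t + r) (γ' (t + r)) (w' (t + r)) ≤ cost ε T L₀ g m (t + r) γ' w' α' :=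
    (hu _ htr _ _).1 ⟨γ', w', α', h, rfl, rfl, rfl⟩
  have hsplit : cost ε T L₀ g m t γ' w' α'
      = (∫ s in t..(t + r), (ε / 2 * ‖α' s‖ ^ 2 + L₀ (γ' s) (w' s) (m s)))
        + cost ε T L₀ g m (t + r) γ' w' α' := by
    simp only [cost]
    rw [← intervalIntegral.integral_add_adjacent_intervals (hαi.add hLi)
      (((h.intervalIntegrable_sq htr hTT).const_mul (ε / 2)).add
        (intervalIntegrable_of_continuousOn_Icc
          (hR.continuousOn_comp hm h.continuousOn h.continuousOn_vel) htr hTT))]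
    ring
  have hdγ : ‖γ (t + r) - γ' (t + r)‖ ≤ 2 * σ' * r := by
    have h1 := hγ's (t + r) ⟨htr', le_rfl⟩
    rw [add_sub_cancel_left] at h1
    have e : γ (t + r) - γ' (t + r)
        = (γ (t + r) - γ t - r • w t) - (γ' (t + r) - γ t - r • w t) := by abel
    rw [e]
    refine (norm_sub_le _ _).trans ?_
    linarith
  have hdw : ‖w (t + r) - w' (t + r)‖ ≤ 2 * σ' * r := by
    have e : w (t + r) - w' (t + r)
        = (w (t + r) - w t - r • (-((1 / ε) • p))) - (w' (t + r) - w t + (r / ε) • p) := by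
      rw [smul_neg, smul_smul, mul_one_div]; abel
    rw [e]
    refine (norm_sub_le _ _).trans ?_
    linarith
  have hnγ : ‖γ (t + r) - γ t‖ ≤ r * (‖w t‖ + σ') := by
    have h2 := norm_le_norm_sub_add (γ (t + r) - γ t) (r • w t)
    rw [norm_smul, Real.norm_of_nonneg hr.le] at h2
    linarith
  have hnw : ‖w (t + r) - w t‖ ≤ r * (‖(1 / ε) • p‖ + σ') := by
    have h2 := norm_le_norm_sub_add (w (t + r) - w t) (r • -((1 / ε) • p))
    rw [norm_smul r, Real.norm_of_nonneg hr.le, norm_neg] at h2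
    linarith
  have hr0 : 0 ≤ r * ‖w t‖ := by positivity
  have hr0' : 0 ≤ r * ‖(1 / ε) • p‖ := by positivity
  have hr0'' : 0 ≤ r * σ' := by positivity
  have hmem : ((t + r, γ (t + r), w (t + r)) : ℝ × Rd d × Rd d) ∈ U := by
    refine hρU ⟨?_, htr, mem_univ _⟩
    rw [Metric.mem_ball, Prod.dist_eq, Prod.dist_eq]
    refine max_lt ?_ (max_lt ?_ ?_)
    · rw [Real.dist_eq, add_sub_cancel_left, abs_of_pos hr]; linarith
    · rw [dist_eq_norm]; linarith
    · rw [dist_eq_norm]; linarith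
  have hmem' : ((t + r, γ' (t + r), w' (t + r)) : ℝ × Rd d × Rd d) ∈ U := by
    refine hρU ⟨?_, htr, mem_univ _⟩
    rw [Metric.mem_ball, Prod.dist_eq, Prod.dist_eq]
    refine max_lt ?_ (max_lt ?_ ?_)
    · rw [Real.dist_eq, add_sub_cancel_left, abs_of_pos hr]; linarith
    · rw [dist_eq_norm]
      have := norm_sub_le_norm_sub_add_norm_sub (γ' (t + r)) (γ (t + r)) (γ t)
      rw [norm_sub_rev (γ' (t + r)) (γ (t + r))] at this
      simp only at this ⊢
      linarith
    · rw [dist_eq_norm]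
      have := norm_sub_le_norm_sub_add_norm_sub (w' (t + r)) (w (t + r)) (w t)
      rw [norm_sub_rev (w' (t + r)) (w (t + r))] at this
      simp only at this ⊢
      linarith
  have hlipr : u (t + r) (γ (t + r)) (w (t + r)) - u (t + r) (γ' (t + r)) (w' (t + r))
      ≤ K * (2 * σ' * r) := by
    have h1 := hK.dist_le_mul _ hmem _ hmem'
    rw [Prod.dist_eq, Prod.dist_eq, Real.dist_eq, dist_self, dist_eq_norm, dist_eq_norm] at h1
    refine (le_abs_self _).trans (h1.trans ?_)
    gcongr
    exact max_le (by positivity) (max_le hdγ hdw)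
  have e : r * r + r * σ' + K * (2 * σ' * r) ≤ σ * r := by
    have : r * σ' + K * (2 * σ' * r) = r * (σ / 2) := by rw [← hσ'1]; ring
    nlinarith
  linarith [pow_two r]

/-! ### Optimality and energy of the curves of the flow -/

theorem absolutelyContinuousOnInterval_of_dist_le {X Y : Type*} [PseudoMetricSpace X]
    [PseudoMetricSpace Y] {f : ℝ → X} {P : ℝ → Y} {a b : ℝ}
    (hP : AbsolutelyContinuousOnInterval P a b)
    (h : ∀ s ∈ uIcc a b, ∀ t ∈ uIcc a b, dist (f s) (f t) ≤ dist (P s) (P t)) :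
    AbsolutelyContinuousOnInterval f a b := by
  rw [absolutelyContinuousOnInterval_iff] at hP ⊢
  intro η hη
  obtain ⟨δ, hδ, hd⟩ := hP η hη
  refine ⟨δ, hδ, fun E hE hsum => lt_of_le_of_lt ?_ (hd E hE hsum)⟩
  exact Finset.sum_le_sum fun i hi => h _ (hE.1 i hi).1 _ (hE.1 i hi).2

theorem IsFlowCurve.continuousOn {ε T : ℝ} {u : ℝ → Rd d → Rd d → ℝ} {x v : Rd d}
    {γ w : ℝ → Rd d} (h : IsFlowCurve ε T u x v γ w) : ContinuousOn γ (Icc 0 T) :=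
  fun s hs => (h.hasDeriv s hs).continuousWithinAt

theorem IsFlowCurve.continuousOn_vel {ε T : ℝ} (hT : 0 ≤ T) {u : ℝ → Rd d → Rd d → ℝ} {x v : Rd d}
    {γ w : ℝ → Rd d} (h : IsFlowCurve ε T u x v γ w) : ContinuousOn w (Icc 0 T) := by
  have h1 := intervalIntegral.continuousOn_primitive_interval' h.integrable left_mem_uIcc
  rw [uIcc_of_le hT] at h1
  exact (continuousOn_const.sub (h1.const_smul (1 / ε))).congr h.integral

theorem IsFlowCurve.vel_zero {ε T : ℝ} (hT : 0 ≤ T) {u : ℝ → Rd d → Rd d → ℝ} {x v : Rd d}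
    {γ w : ℝ → Rd d} (h : IsFlowCurve ε T u x v γ w) : w 0 = v := by
  simpa using h.integral 0 ⟨le_rfl, hT⟩

/-- The value along a curve of the flow is absolutely continuous, although the velocity is only
known to be the integral of an integrable function. -/
theorem IsFlowCurve.absolutelyContinuousOnInterval {ε T : ℝ} (hT : 0 ≤ T)
    {u : ℝ → Rd d → Rd d → ℝ} (hlip : LocallyLipschitzOn (Icc (0 : ℝ) T ×ˢ univ)
      (fun q : ℝ × Rd d × Rd d => u q.1 q.2.1 q.2.2)) {x v : Rd d}
    {γ w : ℝ → Rd d} (h : IsFlowCurve ε T u x v γ w) :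
    AbsolutelyContinuousOnInterval (fun s => u s (γ s) (w s)) 0 T := by
  have h0 : (0 : ℝ) ∈ Icc 0 T := ⟨le_rfl, hT⟩
  have hTT : T ∈ Icc 0 T := ⟨hT, le_rfl⟩
  have hwc := h.continuousOn_vel hT
  have hcurve : ContinuousOn (fun s => (s, γ s, w s)) (Icc 0 T) :=
    continuousOn_id.prodMk (h.continuousOn.prodMk hwc)
  obtain ⟨K, hK⟩ := (hlip.mono (t := Icc (0 : ℝ) T ×ˢ univ)
    (s := (fun s => (s, γ s, w s)) '' Icc 0 T)
    (by rintro _ ⟨s, hs, rfl⟩; exact ⟨hs, mem_univ _⟩)).exists_lipschitzOnWith_of_compact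
      (isCompact_Icc.image_of_continuousOn hcurve)
  -- The increments of the value are dominated by those of the primitive of `G`.
  set G : ℝ → ℝ := fun s => K * (1 + ‖w s‖ +
    ‖(1 / ε) • gradient (fun y => u s (γ s) y) (w s)‖) with hG
  have hai : ∀ {a b}, a ∈ Icc 0 T → b ∈ Icc 0 T → IntervalIntegrable
      (fun s => (1 / ε) • gradient (fun y => u s (γ s) y) (w s)) volume a b := fun ha hb =>
    (h.integrable.smul (1 / ε)).mono_set
      ((uIcc_subset_Icc ha hb).trans (uIcc_of_le hT).symm.subset)
  have hwi : ∀ {a b}, a ∈ Icc 0 T → b ∈ Icc 0 T → IntervalIntegrable w volume a b := fun ha hb =>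
    intervalIntegrable_of_continuousOn_Icc hwc ha hb
  have hGi : ∀ {a b}, a ∈ Icc 0 T → b ∈ Icc 0 T → IntervalIntegrable G volume a b := fun ha hb =>
    ((intervalIntegrable_const.add (hwi ha hb).norm).add (hai ha hb).norm).const_mul _
  refine absolutelyContinuousOnInterval_of_dist_le
    ((hGi h0 hTT).absolutelyContinuousOnInterval_intervalIntegral left_mem_uIcc) ?_
  rw [uIcc_of_le hT]
  have key : ∀ a ∈ Icc 0 T, ∀ b ∈ Icc 0 T, a ≤ b → dist (u a (γ a) (w a)) (u b (γ b) (w b))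
      ≤ dist (∫ τ in (0 : ℝ)..a, G τ) (∫ τ in (0 : ℝ)..b, G τ) := by
    intro a ha b hb hab
    have h1 := hK.dist_le_mul _ (mem_image_of_mem _ ha) _ (mem_image_of_mem _ hb)
    refine h1.trans ?_
    rw [dist_comm (∫ τ in (0 : ℝ)..a, G τ), Real.dist_eq,
      intervalIntegral.integral_interval_sub_left (hGi h0 hb) (hGi h0 ha)]
    refine le_trans ?_ (le_abs_self _)
    rw [hG, intervalIntegral.integral_const_mul]
    refine mul_le_mul_of_nonneg_left ?_ K.2
    rw [intervalIntegral.integral_add (intervalIntegrable_const.add (hwi ha hb).norm)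
      (hai ha hb).norm, intervalIntegral.integral_add intervalIntegrable_const (hwi ha hb).norm]
    have e1 : dist a b = ∫ _ in a..b, (1 : ℝ) := by
      rw [intervalIntegral.integral_const, smul_eq_mul, mul_one, dist_comm, Real.dist_eq,
        abs_of_nonneg (sub_nonneg.2 hab)]
    have e2 : dist (γ a) (γ b) ≤ ∫ τ in a..b, ‖w τ‖ := by
      rw [dist_comm, dist_eq_norm,
        ← sub_eq_integral_of_hasDerivWithinAt h.hasDeriv hwc ha hb]
      exact intervalIntegral.norm_integral_le_integral_norm hab
    have e3 : dist (w a) (w b)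
        ≤ ∫ τ in a..b, ‖(1 / ε) • gradient (fun y => u τ (γ τ) y) (w τ)‖ := by
      have e : w a - w b = ∫ τ in a..b, (1 / ε) • gradient (fun y => u τ (γ τ) y) (w τ) := by
        rw [h.integral a ha, h.integral b hb, intervalIntegral.integral_smul,
          sub_sub_sub_cancel_left, ← smul_sub]
        congr 1
        exact intervalIntegral.integral_interval_sub_left
          (h.integrable.mono_set ((uIcc_subset_Icc h0 hb).trans (uIcc_of_le hT).symm.subset))
          (h.integrable.mono_set ((uIcc_subset_Icc h0 ha).trans (uIcc_of_le hT).symm.subset))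
      rw [dist_eq_norm, e]
      exact intervalIntegral.norm_integral_le_integral_norm hab
    have n1 := dist_nonneg (x := a) (y := b)
    have n2 := dist_nonneg (x := γ a) (y := γ b)
    have n3 := dist_nonneg (x := w a) (y := w b)
    rw [Prod.dist_eq, Prod.dist_eq]
    exact max_le (by linarith) (max_le (by simp only; linarith) (by simp only; linarith))
  intro a ha b hb
  rcases le_total a b with hab | hab
  · exact key a ha b hb hab
  · rw [dist_comm, dist_comm (∫ τ in (0 : ℝ)..a, G τ)]
    exact key b hb a ha hab

/-- The curves of the flow are optimal: their action (even without the cost of the acceleration,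
which is all that is needed) is at most the value. -/
theorem IsFlowCurve.action_le (hR : LagrangianRegular L₀)
    (hG : LagrangianGrowth M₀ L₀) (hg : TerminalCost M₀ g) (hM₀ : 0 < M₀) {ε T : ℝ}
    (hε : 0 < ε) (hT : 0 ≤ T) {m : ℝ → P1 (Rd d)} (hm : IsContinuousFlow T m)
    {u : ℝ → Rd d → Rd d → ℝ} (hu : IsValueFunction ε T L₀ g m u)
    (hlip : LocallyLipschitzOn (Icc (0 : ℝ) T ×ˢ univ)
      (fun q : ℝ × Rd d × Rd d => u q.1 q.2.1 q.2.2))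
    {x v : Rd d} {γ w : ℝ → Rd d} (h : IsFlowCurve ε T u x v γ w) :
    (∫ s in (0 : ℝ)..T, L₀ (γ s) (w s) (m s)) + g (γ T) (m T) ≤ u 0 x v := by
  have h0 : (0 : ℝ) ∈ Icc 0 T := ⟨le_rfl, hT⟩
  have hTT : T ∈ Icc 0 T := ⟨hT, le_rfl⟩
  have hac := h.absolutelyContinuousOnInterval hT hlip
  have hLi := intervalIntegrable_of_continuousOn_Icc
    (hR.continuousOn_comp hm h.continuousOn (h.continuousOn_vel hT)) h0 hTT
  have hderiv : ∀ᵐ t ∂(volume.restrict (Icc 0 T)),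
      deriv (fun s => u s (γ s) (w s)) t ≤ -L₀ (γ t) (w t) (m t) := by
    have hne0 : ∀ᵐ t : ℝ, t ≠ 0 := by simp [ae_iff]
    have hneT : ∀ᵐ t : ℝ, t ≠ T := by simp [ae_iff]
    filter_upwards [ae_restrict_mem measurableSet_Icc, ae_restrict_of_ae hne0,
      ae_restrict_of_ae hneT, h.differentiable, ae_restrict_of_ae hac.ae_differentiableAt,
      ae_restrict_of_ae h.integrable.ae_hasDerivAt_integral] with t ht ht0 htT hdiff hH hprim
    rw [uIcc_of_le hT] at hH hprim
    have ht' : t ∈ Ioo 0 T := ⟨lt_of_le_of_ne ht.1 (Ne.symm ht0), lt_of_le_of_ne ht.2 htT⟩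
    set p := gradient (fun y => u t (γ t) y) (w t) with hp
    have hγ : HasDerivWithinAt γ (w t) (Ioi t) t :=
      ((h.hasDeriv t ht).hasDerivAt (Icc_mem_nhds ht'.1 ht'.2)).hasDerivWithinAt
    have hw : HasDerivWithinAt w (-((1 / ε) • p)) (Ioi t) t := by
      have h1 := ((hprim ht 0 h0).const_smul (1 / ε)).const_sub v
      refine (h1.congr_of_eventuallyEq ?_).hasDerivWithinAt
      filter_upwards [Icc_mem_nhds ht'.1 ht'.2] with s hs using h.integral s hs
    have hslope := (hH ht).hasDerivAt.tendsto_slope_zero_right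
    refine le_of_forall_pos_le_add fun σ hσ => le_of_tendsto hslope ?_
    filter_upwards [self_mem_nhdsWithin, hu.eventually_le_sub hR hG hg hM₀ hε ⟨ht.1, ht'.2⟩ hm
      hlip hdiff.hasGradientAt hγ hw hσ] with r hr hle
    rw [mem_Ioi] at hr
    rw [smul_eq_mul, inv_mul_le_iff₀ hr]
    linarith
  have hint := hac.integral_deriv_eq_sub
  have hmono := intervalIntegral.integral_mono_ae_restrict hT hac.intervalIntegrable_deriv
    hLi.neg hderiv
  rw [hint, h.init, h.vel_zero hT] at hmono
  simp only [Pi.neg_apply, intervalIntegral.integral_neg] at hmono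
  -- At the final time every admissible curve has the cost `g (γ T) (m T)`.
  have hend : g (γ T) (m T) ≤ u T (γ T) (w T) := by
    refine (hu T hTT (γ T) (w T)).2 ?_
    rintro c ⟨γ', w', α', -, hγ', -, rfl⟩
    simp [cost, hγ']
  linarith

/-- The bound on the kinetic energy of the curves of the flow that start in a ball of radius `r`
of the phase space. It does not depend on `ε`. -/
def energyBound (M₀ T r : ℝ) : ℝ :=
  8 * M₀ * (lineExcess M₀ T r + 2 * M₀ * (M₀ * (T + 3)) ^ 2 * T)

theorem energyBound_nonneg (hM₀ : 0 < M₀) {T r : ℝ} (hT : 0 ≤ T) (hr : 0 ≤ r) :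
    0 ≤ energyBound M₀ T r := by
  unfold energyBound lineExcess
  positivity

theorem IsFlowCurve.energy_le (hR : LagrangianRegular L₀)
    (hG : LagrangianGrowth M₀ L₀) (hg : TerminalCost M₀ g) (hM₀ : 0 < M₀) {ε T : ℝ}
    (hε : 0 < ε) (hT : 0 ≤ T) {m : ℝ → P1 (Rd d)} (hm : IsContinuousFlow T m)
    {u : ℝ → Rd d → Rd d → ℝ} (hu : IsValueFunction ε T L₀ g m u)
    (hlip : LocallyLipschitzOn (Icc (0 : ℝ) T ×ˢ univ)
      (fun q : ℝ × Rd d × Rd d => u q.1 q.2.1 q.2.2))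
    {x v : Rd d} {γ w : ℝ → Rd d} (h : IsFlowCurve ε T u x v γ w) {r : ℝ} (hv : ‖v‖ ≤ r) :
    ∫ s in (0 : ℝ)..T, ‖w s‖ ^ 2 ≤ energyBound M₀ T r := by
  have h0 : (0 : ℝ) ∈ Icc 0 T := ⟨le_rfl, hT⟩
  have h1 := action_ge hR hG hg hM₀ h0 hm h.hasDeriv (h.continuousOn_vel hT)
  have h2 := h.action_le hR hG hg hM₀ hε hT hm hu hlip
  have h3 := hu.le_action_rest hR hG hg hM₀ h0 hm x v
  have h4 := lineExcess_mono hM₀ hT (norm_nonneg v) hv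
  rw [h.init] at h1
  have h5 : 1 / (8 * M₀) * (∫ s in (0 : ℝ)..T, ‖w s‖ ^ 2)
      ≤ lineExcess M₀ T r + 2 * M₀ * (M₀ * (T + 3)) ^ 2 * T := by linarith
  calc ∫ s in (0 : ℝ)..T, ‖w s‖ ^ 2
      = 8 * M₀ * (1 / (8 * M₀) * ∫ s in (0 : ℝ)..T, ‖w s‖ ^ 2) := by field_simp
    _ ≤ _ := by unfold energyBound; gcongr

theorem IsFlowCurve.norm_sub_le {ε T : ℝ} (hT : 0 ≤ T)
    {u : ℝ → Rd d → Rd d → ℝ} {x v : Rd d} {γ w : ℝ → Rd d} (h : IsFlowCurve ε T u x v γ w)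
    {A : ℝ} (hA : ∫ s in (0 : ℝ)..T, ‖w s‖ ^ 2 ≤ A) {s t : ℝ} (hs : s ∈ Icc 0 T)
    (ht : t ∈ Icc 0 T) : ‖γ s - γ t‖ ≤ √(|s - t| * A) := by
  wlog hst : t ≤ s generalizing s t
  · rw [norm_sub_rev, abs_sub_comm]
    exact this ht hs (le_of_not_ge hst)
  have h0 : (0 : ℝ) ∈ Icc 0 T := ⟨le_rfl, hT⟩
  have hTT : T ∈ Icc 0 T := ⟨hT, le_rfl⟩
  have hw := h.continuousOn_vel hT
  refine Real.le_sqrt_of_sq_le ?_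
  rw [← sub_eq_integral_of_hasDerivWithinAt h.hasDeriv hw ht hs,
    abs_of_nonneg (sub_nonneg.2 hst)]
  refine (sq_norm_integral_le hst (intervalIntegrable_of_continuousOn_Icc hw ht hs)
    (intervalIntegrable_of_continuousOn_Icc (hw.norm.pow 2) ht hs)).trans ?_
  refine mul_le_mul_of_nonneg_left (le_trans ?_ hA) (sub_nonneg.2 hst)
  exact intervalIntegral.integral_mono_interval ht.1 hst hs.2
    (Eventually.of_forall fun _ => by positivity)
    (intervalIntegrable_of_continuousOn_Icc (hw.norm.pow 2) h0 hTT)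

/-! ### Uniform estimates on the flow of a solution -/

/-- A bounded set of initial data is confined by the flow, uniformly in `ε`, and travels along
curves that are Hölder continuous of exponent `1/2`, uniformly in `ε`. -/
theorem IsSolution.exists_flow (hR : LagrangianRegular L₀)
    (hG : LagrangianGrowth M₀ L₀) (hg : TerminalCost M₀ g) (hM₀ : 0 < M₀) {ε T : ℝ}
    (hε : 0 < ε) (hT : 0 ≤ T) {μ₀ : Measure (Rd d × Rd d)} {u : ℝ → Rd d → Rd d → ℝ}
    {μ : ℝ → P1 (Rd d × Rd d)} (hsol : IsSolution ε T L₀ g μ₀ u μ) {r : ℝ}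
    (hr : ∀ᵐ z ∂μ₀, ‖z‖ ≤ r) :
    ∃ X : ℝ → Rd d × Rd d → Rd d,
      (∀ t ∈ Icc 0 T, AEMeasurable (X t) μ₀ ∧ (spaceMarginal (μ t)).toMeasure = μ₀.map (X t)) ∧
      ∀ᵐ z ∂μ₀, (∀ t ∈ Icc 0 T, ‖X t z‖ ≤ r + √(T * energyBound M₀ T r)) ∧
        ∀ s ∈ Icc 0 T, ∀ t ∈ Icc 0 T, ‖X s z - X t z‖ ≤ √(|s - t| * energyBound M₀ T r) := by
  obtain ⟨Φ, hΦ, hmap⟩ := hsol.flow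
  refine ⟨fun t z => (Φ t z).1, fun t ht => ⟨(hmap t ht).1.fst, ?_⟩, ?_⟩
  · change (μ t).toMeasure.map Prod.fst = _
    rw [(hmap t ht).2, AEMeasurable.map_map_of_aemeasurable measurable_fst.aemeasurable
      (hmap t ht).1]
    rfl
  · filter_upwards [hΦ, hr] with z hz hzr
    have hr0 : 0 ≤ r := (norm_nonneg z).trans hzr
    have hen := hz.energy_le hR hG hg hM₀ hε hT hsol.continuousFlow.spaceMarginal hsol.value
      hsol.locallyLipschitz ((norm_snd_le z).trans hzr)
    have hhol := fun s (hs : s ∈ Icc 0 T) t (ht : t ∈ Icc 0 T) => hz.norm_sub_le hT hen hs ht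
    refine ⟨fun t ht => ?_, hhol⟩
    have h0 : (0 : ℝ) ∈ Icc 0 T := ⟨le_rfl, hT⟩
    have h1 : ‖(Φ t z).1 - (Φ 0 z).1‖ ≤ √(|t - 0| * energyBound M₀ T r) := hhol t ht 0 h0
    have h2 : (Φ 0 z).1 = z.1 := hz.init
    rw [h2, sub_zero, abs_of_nonneg ht.1] at h1
    have h3 : √(t * energyBound M₀ T r) ≤ √(T * energyBound M₀ T r) :=
      Real.sqrt_le_sqrt (mul_le_mul_of_nonneg_right ht.2 (energyBound_nonneg hM₀ hT hr0))
    have h4 := norm_le_norm_add_norm_sub' (Φ t z).1 z.1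
    have h5 := (norm_fst_le z).trans hzr
    linarith

theorem InitialDatum.exists_ae_norm_le {μ₀ : Measure (Rd d × Rd d)} (h : InitialDatum μ₀) :
    ∃ r, 0 ≤ r ∧ ∀ᵐ z ∂μ₀, ‖z‖ ≤ r := by
  obtain ⟨r, hr⟩ := h.isCompact_support.isBounded.exists_norm_le
  refine ⟨max r 0, le_max_right _ _, ?_⟩
  filter_upwards [Measure.support_mem_ae (μ := μ₀)] with z hz
  exact (hr z hz).trans (le_max_left _ _)

end

end MFG

end

theorem theorem4p4 (d : ℕ) (T M₀ : ℝ) (hT : 0 < T) (hM₀ : 0 < M₀)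
    (L₀ : MFG.Rd d → MFG.Rd d → MFG.P1 (MFG.Rd d) → ℝ)
    (g : MFG.Rd d → MFG.P1 (MFG.Rd d) → ℝ)
    (μ₀ : Measure (MFG.Rd d × MFG.Rd d))
    (hL_reg : MFG.LagrangianRegular L₀)
    (hL_growth : MFG.LagrangianGrowth M₀ L₀)
    (hL_mod : MFG.LagrangianModulus L₀)
    (hμ₀ : MFG.InitialDatum μ₀)
    (hg : MFG.TerminalCost M₀ g)
    (u : ℝ → ℝ → MFG.Rd d → MFG.Rd d → ℝ)
    (μ : ℝ → ℝ → MFG.P1 (MFG.Rd d × MFG.Rd d))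
    (hsol : ∀ ε > 0, MFG.IsSolution ε T L₀ g μ₀ (u ε) (μ ε))
    (m : ℝ → ℝ → MFG.P1 (MFG.Rd d))
    (hm : ∀ ε t, m ε t = MFG.spaceMarginal (μ ε t)) :
    (∃ C : ℝ, ∀ ε > 0, ∀ t ∈ Icc (0 : ℝ) T,
      Integrable (fun x => ‖x‖ ^ 2) (m ε t).toMeasure ∧
      ∫ x, ‖x‖ ^ 2 ∂(m ε t).toMeasure ≤ C) ∧
    IsTightMeasureSet {ρ : Measure (MFG.Rd d) |
      ∃ ε > 0, ∃ t ∈ Icc (0 : ℝ) T, ρ = (m ε t).toMeasure} ∧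
    (∀ e : ℕ → ℝ, (∀ n, 0 < e n) → Tendsto e atTop (𝓝 0) →
      ∃ φ : ℕ → ℕ, StrictMono φ ∧ ∃ m₀ : ℝ → MFG.P1 (MFG.Rd d),
        MFG.IsContinuousFlow T m₀ ∧ MFG.FlowTendsto T (fun k => m (e (φ k))) m₀) := by
  have hprob : IsProbabilityMeasure μ₀ := hμ₀.isProbabilityMeasure
  obtain ⟨r, hr0, hr⟩ := hμ₀.exists_ae_norm_le
  set A := MFG.energyBound M₀ T r
  set R := r + √(T * A)
  set K : Set (MFG.Rd d) := Metric.closedBall 0 R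
  have hK : IsCompact K := isCompact_closedBall _ _
  have hA : 0 ≤ A := MFG.energyBound_nonneg hM₀ hT.le hr0
  have hflow := fun ε (hε : 0 < ε) =>
    (hsol ε hε).exists_flow hL_reg hL_growth hg hM₀ hε hT.le hr
  have hsupp : ∀ ε > 0, ∀ t ∈ Icc (0 : ℝ) T, (m ε t).toMeasure Kᶜ = 0 := by
    intro ε hε t ht
    obtain ⟨X, hX, hbd⟩ := hflow ε hε
    rw [hm, (hX t ht).2, Measure.map_apply_of_aemeasurable (hX t ht).1
      Metric.isClosed_closedBall.measurableSet.compl]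
    change μ₀ {z | ¬ X t z ∈ K} = 0
    rw [← ae_iff]
    filter_upwards [hbd] with z hz
    simpa [K] using hz.1 t ht
  have hae : ∀ ε > 0, ∀ t ∈ Icc (0 : ℝ) T, ∀ᵐ x ∂(m ε t).toMeasure, ‖x‖ ≤ R := by
    intro ε hε t ht
    have h1 : ∀ᵐ x ∂(m ε t).toMeasure, x ∈ K := by
      rw [ae_iff]; exact hsupp ε hε t ht
    simpa [K] using h1
  refine ⟨⟨R ^ 2, fun ε hε t ht => ?_⟩, ?_, fun e he _ => ?_⟩
  · have := (m ε t).isProbabilityMeasure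
    have h1 : ∀ᵐ x ∂(m ε t).toMeasure, ‖x‖ ^ 2 ≤ R ^ 2 := by
      filter_upwards [hae ε hε t ht] with x hx
      gcongr
    have h2 : Integrable (fun x => ‖x‖ ^ 2) (m ε t).toMeasure := by
      refine Integrable.of_bound (by fun_prop) (R ^ 2) ?_
      filter_upwards [h1] with x hx
      rwa [Real.norm_of_nonneg (by positivity)]
    refine ⟨h2, (integral_mono_ae h2 (integrable_const _) h1).trans_eq ?_⟩
    simp
  · rw [isTightMeasureSet_iff_exists_isCompact_measure_compl_le]
    intro η _
    refine ⟨K, hK, ?_⟩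
    rintro ρ ⟨ε, hε, t, ht, rfl⟩
    rw [hsupp ε hε t ht]
    exact zero_le
  · refine MFG.exists_flowTendsto_subsequence hT.le hK (fun k => m (e k))
      (fun k t ht => hsupp _ (he k) t ht) fun φ σ hσ => ?_
    obtain ⟨δ, hδ, hφ⟩ := Metric.uniformContinuousOn_iff.1
      (hK.uniformContinuousOn_of_continuous φ.continuous.continuousOn) σ hσ
    refine ⟨δ ^ 2 / (A + 1), by positivity, fun k s hs t ht hst => ?_⟩
    obtain ⟨X, hX, hbd⟩ := hflow (e k) (he k)
    have hint : ∀ τ ∈ Icc 0 T, Integrable (fun z => φ (X τ z)) μ₀ ∧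
        ∫ x, φ x ∂(m (e k) τ).toMeasure = ∫ z, φ (X τ z) ∂μ₀ := by
      intro τ hτ
      refine ⟨Integrable.of_bound
        (φ.continuous.comp_aestronglyMeasurable (hX τ hτ).1.aestronglyMeasurable) ‖φ‖
        (Eventually.of_forall fun z => φ.norm_coe_le_norm _), ?_⟩
      rw [hm, (hX τ hτ).2, integral_map (hX τ hτ).1 φ.continuous.aestronglyMeasurable]
    rw [(hint s hs).2, (hint t ht).2, ← integral_sub (hint s hs).1 (hint t ht).1,
      ← Real.norm_eq_abs]
    refine (norm_integral_le_of_norm_le_const (C := σ) ?_).trans_eq (by simp)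
    filter_upwards [hbd] with z hz
    rw [← dist_eq_norm]
    refine (hφ _ (by simpa [K] using hz.1 s hs) _ (by simpa [K] using hz.1 t ht) ?_).le
    rw [dist_eq_norm]
    refine (hz.2 s hs t ht).trans_lt ?_
    rw [Real.sqrt_lt' hδ]
    rw [lt_div_iff₀ (by positivity)] at hst
    linarith [abs_nonneg (s - t)]
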